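/- **Definitions.** Let $\mathcal N$ be a smooth $\mathfrak n$-dimensional manifold with a smooth symmetric 2-covariant tensor $\gamma$, a smooth covector $\boldsymbol\ell$ and a smooth function $\ell^{(2)}$. These form *metric hypersurface data* if for every $p\in\mathcal N$ the symmetric bilinear form $$\mathcal A|_p\big((W,a),(Z,b)\big)=\gamma(W,Z)+a\,\boldsymbol\ell(Z)+b\,\boldsymbol\ell(W)+ab\,\ell^{(2)}$$ on $T_p\mathcal N\times\mathbb R$ is non-degenerate (no signature is prescribed). The vector field $n$ and the function $n^{(2)}$ are defined by $\mathcal A((n,n^{(2)}),(Z,b))=b$ for all $(Z,b)$, i.e. $\gamma(n,\cdot)+n^{(2)}\boldsymbol\ell=0$ and $\boldsymbol\ell(n)+n^{(2)}\ell^{(2)}=1$. *Null hypersurface data* $\{\mathcal N,\gamma,\boldsymbol\ell,\ell^{(2)},\mathbf Y\}$ consist of metric hypersurface data with $n^{(2)}=0$ everywhere on $\mathcal N$ and a smooth symmetric 2-covariant tensor $\mathbf Y$. Put $$\mathbf F=\tfrac12 d\boldsymbol\ell,\qquad \boldsymbol s=\mathbf F(n,\cdot),\qquad \mathbf U=\tfrac12\pounds_n\gamma+\boldsymbol\ell\otimes_s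 dn^{(2)},$$ where $\otimes_s$ is the symmetrized tensor product. Let $\overset{\circ}{\nabla}$ be the unique torsion-free connection on $\mathcal N$ with $$(\overset{\circ}{\nabla}_X\gamma)(Z,W)=-\mathbf U(X,Z)\boldsymbol\ell(W)-\mathbf U(X,W)\boldsymbol\ell(Z),\qquad (\overset{\circ}{\nabla}_X\boldsymbol\ell)(Z)+(\overset{\circ}{\nabla}_Z\boldsymbol\ell)(X)=-2\ell^{(2)}\mathbf U(X,Z),$$ and let $\overset{\circ}{\Sigma}=\pounds_n\overset{\circ}{\nabla}$, i.e. $\overset{\circ}{\Sigma}(X,W)=[n,\overset{\circ}{\nabla}_XW]-\overset{\circ}{\nabla}_X[n,W]-\overset{\circ}{\nabla}_{[n,X]}W$. Let $\psi:S\hookrightarrow\mathcal N$ be a smoothly embedded submanifold of dimension $\mathfrak n-1$ to which $n$ is everywhere transverse. Let $\boldsymbol\nu$ be the unique covector along $\psi(S)$ that vanishes on vectors tangent to $\psi(S)$ and satisfies $\boldsymbol\nu(n)=1$. Let $h=\psi^\star\gamma$, which is a non-degenerate metric, with contravariant metric $h^\sharp$ and Levi-Civita connection $\nabla^h$. Write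 $T_\parallel=\psi^\star T$ for covariant tensors $T$ on $\mathcal N$, with components $T_{A_1\cdots A_k}$ in a local frame of $S$; in particular $\boldsymbol\ell_\parallel=\psi^\star\boldsymbol\ell$. Put $\ell^\sharp_\parallel=h^\sharp(\boldsymbol\ell_\parallel,\cdot)$, with components $\ell^A$, and $\ell^{(2)}_\parallel=h^\sharp(\boldsymbol\ell_\parallel,\boldsymbol\ell_\parallel)$. With round brackets denoting symmetrization, the tensor $\mathfrak S_\parallel$ on $S$ is defined by $$\begin{aligned}\mathfrak S_{AB}={}&(\pounds_n\mathbf Y)_{AB}-\tfrac12\big(\ell^{(2)}-\ell^{(2)}_\parallel\big)(\pounds_n\mathbf U)_{AB}-2\nabla^h_{(A}s_{B)}\\&-\Big(\tfrac12 n(\ell^{(2)})+\ell^C\ell^D\mathrm U_{CD}-2\ell^Cs_C\Big)\mathrm U_{AB}+\ell^C\Big(-\nabla^h_C\mathrm U_{AB}+2\nabla^h_{(A}\mathrm U_{B)C}\Big).\end{aligned}$$ **Lemma.** For null hypersurface data and $\psi:S\hookrightarrow\mathcal N$ as above, on $S$, $$\mathfrak S_\parallel=-\psi^\star\Big(\boldsymbol\nu\big(\overset{\circ}{\Sigma}-n\otimes\pounds_n\mathbf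 Y\big)\Big)+\tfrac12\big(\ell^{(2)}-\ell^{(2)}_\parallel\big)(\pounds_n\mathbf U)_\parallel+\Big(\tfrac12 n(\ell^{(2)})+\mathbf U_\parallel(\ell^\sharp_\parallel,\ell^\sharp_\parallel)-2\boldsymbol s_\parallel(\ell^\sharp_\parallel)\Big)\mathbf U_\parallel .$$ In particular, if $\mathbf U=0$ everywhere on $\mathcal N$, then $$\mathfrak S_\parallel=-\psi^\star\Big(\boldsymbol\nu\big(\overset{\circ}{\Sigma}-n\otimes\pounds_n\mathbf Y\big)\Big).$$ -/

import Mathlib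

open scoped Manifold ContDiff Topology
open Bundle VectorField

set_option linter.unusedSectionVars false
set_option linter.deprecated false

namespace NullHyp

noncomputable section

section Tensors

variable {E : Type*} [NormedAddCommGroup E] [NormedSpace ℝ E]
  {M : Type*} [TopologicalSpace M] [ChartedSpace E M] [IsManifold 𝓘(ℝ, E) ∞ M]

/-- Vector fields on a manifold `M` modelled on `E`. -/
abbrev VField (E : Type*) [NormedAddCommGroup E] [NormedSpace ℝ E]
    (M : Type*) [TopologicalSpace M] [ChartedSpace E M] :=
  Π p : M, TangentSpace 𝓘(ℝ, E) p

/-- Fields of functions of one tangent vector; used for covectors. -/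
abbrev Tensor1 (E : Type*) [NormedAddCommGroup E] [NormedSpace ℝ E]
    (M : Type*) [TopologicalSpace M] [ChartedSpace E M] :=
  Π p : M, TangentSpace 𝓘(ℝ, E) p → ℝ

/-- Fields of functions of two tangent vectors; used for 2-covariant tensors. -/
abbrev Tensor2 (E : Type*) [NormedAddCommGroup E] [NormedSpace ℝ E]
    (M : Type*) [TopologicalSpace M] [ChartedSpace E M] :=
  Π p : M, TangentSpace 𝓘(ℝ, E) p → TangentSpace 𝓘(ℝ, E) p → ℝ

/-- Affine connections on `M`; `D Y p u` is the derivative of `Y` at `p` along `u`. -/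
abbrev Connection (E : Type*) [NormedAddCommGroup E] [NormedSpace ℝ E]
    (M : Type*) [TopologicalSpace M] [ChartedSpace E M] [IsManifold 𝓘(ℝ, E) ∞ M] :=
  CovariantDerivative 𝓘(ℝ, E) E (TangentSpace 𝓘(ℝ, E) : M → Type _)

/-- A local extension of a tangent vector `u` at `p` to a vector field which is smooth near `p`
(constant in the trivialization of the tangent bundle at `p`). The tensors below are evaluated at
tangent vectors through such extensions; by tensoriality the choice does not matter. -/
def ext {p : M} (u : TangentSpace 𝓘(ℝ, E) p) : VField E M := FiberBundle.extend E u

/-- The Lie bracket `[X, Y]`. -/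
def lieBr (X Y : VField E M) : VField E M := fun p => mlieBracket 𝓘(ℝ, E) X Y p

/-- The differential of a function: `dir f p u` is the derivative of `f` at `p` along `u`. -/
abbrev dir (f : M → ℝ) (p : M) : TangentSpace 𝓘(ℝ, E) p →L[ℝ] ℝ := mvfderiv 𝓘(ℝ, E) f p

/-- Exterior derivative of a covector, `dα(U, W) = U(α(W)) - W(α(U)) - α([U, W])`. -/
def extDer (α : Tensor1 E M) : Tensor2 E M := fun p u w =>
  dir (fun q => α q (ext w q)) p u - dir (fun q => α q (ext u q)) p w
    - α p (lieBr (ext u) (ext w) p)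

/-- Lie derivative of a 2-covariant tensor,
`(£_Z T)(U, W) = Z(T(U, W)) - T([Z, U], W) - T(U, [Z, W])`. -/
def lieDer (Z : VField E M) (T : Tensor2 E M) : Tensor2 E M := fun p u w =>
  dir (fun q => T q (ext u q) (ext w q)) p (Z p)
    - T p (lieBr Z (ext u) p) w - T p u (lieBr Z (ext w) p)

/-- Covariant derivative of a covector: `covDer1 D α p u w` is `(D_u α)(w)`. -/
def covDer1 (D : Connection E M) (α : Tensor1 E M) : Tensor2 E M := fun p u w =>
  dir (fun q => α q (ext w q)) p u - α p (D (ext w) p u)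

/-- Covariant derivative of a 2-covariant tensor: `covDer2 D T p u v w` is
`(D_u T)(v, w)`. -/
def covDer2 (D : Connection E M) (T : Tensor2 E M) (p : M)
    (u v w : TangentSpace 𝓘(ℝ, E) p) : ℝ :=
  dir (fun q => T q (ext v q) (ext w q)) p u
    - T p (D (ext v) p u) w - T p v (D (ext w) p u)

/-- Lie derivative of a connection along `Z`, the (1,2)-tensor
`(£_Z D)(U, W) = [Z, D_U W] - D_U [Z, W] - D_{[Z, U]} W`. -/
def lieConn (Z : VField E M) (D : Connection E M) (p : M)
    (u w : TangentSpace 𝓘(ℝ, E) p) : TangentSpace 𝓘(ℝ, E) p :=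
  lieBr Z (fun q => D (ext w) q (ext u q)) p
    - D (lieBr Z (ext w)) p u - D (ext w) p (lieBr Z (ext u) p)

variable [FiniteDimensional ℝ E]

/-- Auxiliary regularity of a pair (symmetric bilinear form, covector), used to construct
connections. -/
structure Pre (g : Π p : M, TangentSpace 𝓘(ℝ, E) p →L[ℝ] TangentSpace 𝓘(ℝ, E) p →L[ℝ] ℝ)
    (l : Π p : M, TangentSpace 𝓘(ℝ, E) p →L[ℝ] ℝ) : Prop where
  symm : ∀ p u w, g p u w = g p w u
  dg : ∀ (p : M) (X Y : VField E M), MDiffAt (T% X) p → MDiffAt (T% Y) p →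
    MDifferentiableAt 𝓘(ℝ, E) 𝓘(ℝ, ℝ) (fun q => g q (X q) (Y q)) p
  dl : ∀ (p : M) (X : VField E M), MDiffAt (T% X) p →
    MDifferentiableAt 𝓘(ℝ, E) 𝓘(ℝ, ℝ) (fun q => l q (X q)) p

section
variable (g : Π p : M, TangentSpace 𝓘(ℝ, E) p →L[ℝ] TangentSpace 𝓘(ℝ, E) p →L[ℝ] ℝ)
    (l : Π p : M, TangentSpace 𝓘(ℝ, E) p →L[ℝ] ℝ)

/-- The Koszul expression of a symmetric 2-covariant tensor. -/
def kos (Y : VField E M) (p : M) (X Z : VField E M) : ℝ :=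
  (1/2) * (dir (fun q => g q (Y q) (Z q)) p (X p) + dir (fun q => g q (X q) (Z q)) p (Y p)
    - dir (fun q => g q (X q) (Y q)) p (Z p) + g p (lieBr X Y p) (Z p)
    - g p (lieBr Y Z p) (X p) + g p (lieBr Z X p) (Y p))

/-- The analogue of the Koszul expression for a covector. -/
def kosl (Y : VField E M) (p : M) (X : VField E M) : ℝ :=
  (1/2) * (dir (fun q => l q (Y q)) p (X p) + dir (fun q => l q (X q)) p (Y p)
    + l p (lieBr X Y p))

variable {g l}

theorem dir_add {f f' : M → ℝ} {p : M} (u : TangentSpace 𝓘(ℝ, E) p)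
    (hf : MDiffAt f p) (hf' : MDiffAt f' p) :
    dir (fun q => f q + f' q) p u = dir f p u + dir f' p u := by
  have := mvfderiv_add hf hf'
  exact congr($this u)

theorem dir_mul {f f' : M → ℝ} {p : M} (u : TangentSpace 𝓘(ℝ, E) p)
    (hf : MDiffAt f p) (hf' : MDiffAt f' p) :
    dir (fun q => f q * f' q) p u = f p * dir f' p u + f' p * dir f p u := by
  have := mvfderiv_mul hf hf'
  have := congr($this u)
  simpa [dir] using! this

theorem dir_d {f : M → ℝ} {p : M} (u : TangentSpace 𝓘(ℝ, E) p) : d% f p u = dir f p u := rfl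

theorem lieBr_smul_left {f : M → ℝ} {X Y : VField E M} {p : M} (hf : MDiffAt f p)
    (hX : MDiffAt (T% X) p) :
    lieBr (f • X) Y p = f p • lieBr X Y p - dir f p (Y p) • X p := by
  simp only [lieBr, mlieBracket_smul_left hf hX, dir_d]
  module

theorem lieBr_smul_right {f : M → ℝ} {X Y : VField E M} {p : M} (hf : MDiffAt f p)
    (hX : MDiffAt (T% X) p) :
    lieBr Y (f • X) p = f p • lieBr Y X p + dir f p (Y p) • X p := by
  simp only [lieBr, mlieBracket_smul_right hf hX, dir_d]
  module

theorem lieBr_add_left {X X' Y : VField E M} {p : M} (hX : MDiffAt (T% X) p)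
    (hX' : MDiffAt (T% X') p) : lieBr (X + X') Y p = lieBr X Y p + lieBr X' Y p :=
  mlieBracket_add_left hX hX'

theorem lieBr_add_right {X X' Y : VField E M} {p : M} (hX : MDiffAt (T% X) p)
    (hX' : MDiffAt (T% X') p) : lieBr Y (X + X') p = lieBr Y X p + lieBr Y X' p :=
  mlieBracket_add_right hX hX'

theorem lieBr_swap (X Y : VField E M) (p : M) : lieBr X Y p = - lieBr Y X p :=
  mlieBracket_swap_apply

theorem kos_tens1 (h : Pre g l) {Y Z : VField E M} {p : M} (hY : MDiffAt (T% Y) p)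
    (hZ : MDiffAt (T% Z) p) : TensorialAt 𝓘(ℝ, E) E (fun X => kos g Y p X Z) p where
  smul {f X} hf hX := by
    simp only [kos, Pi.smul_apply', map_smul, ContinuousLinearMap.smul_apply, smul_eq_mul]
    rw [dir_mul _ hf (h.dg p X Z hX hZ), dir_mul _ hf (h.dg p X Y hX hY),
      lieBr_smul_left hf hX, lieBr_smul_right hf hX]
    simp only [map_add, map_sub, map_smul, ContinuousLinearMap.add_apply,
      ContinuousLinearMap.sub_apply, ContinuousLinearMap.smul_apply, smul_eq_mul]
    ring
  add {X X'} hX hX' := by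
    simp only [kos, Pi.add_apply, map_add, ContinuousLinearMap.add_apply]
    rw [dir_add _ (h.dg p X Z hX hZ) (h.dg p X' Z hX' hZ),
      dir_add _ (h.dg p X Y hX hY) (h.dg p X' Y hX' hY),
      lieBr_add_left hX hX', lieBr_add_right hX hX']
    simp only [map_add, ContinuousLinearMap.add_apply]
    ring

theorem kos_tens2 (h : Pre g l) {Y X : VField E M} {p : M} (hY : MDiffAt (T% Y) p)
    (hX : MDiffAt (T% X) p) : TensorialAt 𝓘(ℝ, E) E (fun Z => kos g Y p X Z) p where
  smul {f Z} hf hZ := by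
    simp only [kos, Pi.smul_apply', map_smul, smul_eq_mul]
    rw [dir_mul _ hf (h.dg p X Z hX hZ), dir_mul _ hf (h.dg p Y Z hY hZ),
      lieBr_smul_left hf hZ, lieBr_smul_right hf hZ]
    simp only [map_add, map_sub, map_smul, ContinuousLinearMap.add_apply,
      ContinuousLinearMap.sub_apply, ContinuousLinearMap.smul_apply, smul_eq_mul,
      h.symm p (Z p)]
    ring
  add {Z Z'} hZ hZ' := by
    simp only [kos, Pi.add_apply, map_add]
    rw [dir_add _ (h.dg p X Z hX hZ) (h.dg p X Z' hX hZ'),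
      dir_add _ (h.dg p Y Z hY hZ) (h.dg p Y Z' hY hZ'),
      lieBr_add_left hZ hZ', lieBr_add_right hZ hZ']
    simp only [map_add, ContinuousLinearMap.add_apply]
    ring

theorem kos_add (h : Pre g l) {X Y Y' Z : VField E M} {p : M} (hX : MDiffAt (T% X) p)
    (hY : MDiffAt (T% Y) p) (hY' : MDiffAt (T% Y') p) (hZ : MDiffAt (T% Z) p) :
    kos g (Y + Y') p X Z = kos g Y p X Z + kos g Y' p X Z := by
  simp only [kos, Pi.add_apply, map_add, ContinuousLinearMap.add_apply]
  rw [dir_add _ (h.dg p Y Z hY hZ) (h.dg p Y' Z hY' hZ),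
    dir_add _ (h.dg p X Y hX hY) (h.dg p X Y' hX hY'),
    lieBr_add_left hY hY', lieBr_add_right hY hY']
  simp only [map_add, ContinuousLinearMap.add_apply]
  ring

theorem kos_leib (h : Pre g l) {f : M → ℝ} {X Y Z : VField E M} {p : M} (hf : MDiffAt f p)
    (hX : MDiffAt (T% X) p) (hY : MDiffAt (T% Y) p) (hZ : MDiffAt (T% Z) p) :
    kos g (f • Y) p X Z = f p * kos g Y p X Z + dir f p (X p) * g p (Y p) (Z p) := by
  simp only [kos, Pi.smul_apply', map_smul, ContinuousLinearMap.smul_apply, smul_eq_mul]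
  rw [dir_mul _ hf (h.dg p Y Z hY hZ), dir_mul _ hf (h.dg p X Y hX hY),
    lieBr_smul_left hf hY, lieBr_smul_right hf hY]
  simp only [map_add, map_sub, map_smul, ContinuousLinearMap.add_apply,
    ContinuousLinearMap.sub_apply, ContinuousLinearMap.smul_apply, smul_eq_mul,
    h.symm p (X p)]
  ring

theorem kosl_tens (h : Pre g l) {Y : VField E M} {p : M} (hY : MDiffAt (T% Y) p) :
    TensorialAt 𝓘(ℝ, E) E (fun X => kosl l Y p X) p where
  smul {f X} hf hX := by
    simp only [kosl, Pi.smul_apply', map_smul, smul_eq_mul]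
    rw [dir_mul _ hf (h.dl p X hX), lieBr_smul_left hf hX]
    have e : dir (fun q => l q (Y q)) p (f p • X p) = f p * dir (fun q => l q (Y q)) p (X p) := by
      simp [dir]
    simp only [map_sub, map_smul, smul_eq_mul]
    ring
  add {X X'} hX hX' := by
    simp only [kosl, Pi.add_apply, map_add]
    rw [dir_add _ (h.dl p X hX) (h.dl p X' hX'), lieBr_add_left hX hX']
    simp only [map_add]
    ring

theorem kosl_add (h : Pre g l) {X Y Y' : VField E M} {p : M}
    (hY : MDiffAt (T% Y) p) (hY' : MDiffAt (T% Y') p) :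
    kosl l (Y + Y') p X = kosl l Y p X + kosl l Y' p X := by
  simp only [kosl, Pi.add_apply, map_add]
  rw [dir_add _ (h.dl p Y hY) (h.dl p Y' hY'), lieBr_add_right hY hY']
  simp only [map_add]
  ring

theorem kosl_leib (h : Pre g l) {f : M → ℝ} {X Y : VField E M} {p : M} (hf : MDiffAt f p)
    (hY : MDiffAt (T% Y) p) :
    kosl l (f • Y) p X = f p * kosl l Y p X + dir f p (X p) * l p (Y p) := by
  simp only [kosl, Pi.smul_apply', map_smul, smul_eq_mul]
  rw [dir_mul _ hf (h.dl p Y hY), lieBr_smul_right hf hY]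
  simp only [map_add, map_smul, smul_eq_mul]
  ring

theorem mdiff_ext {p : M} (u : TangentSpace 𝓘(ℝ, E) p) : MDiffAt (T% (ext u)) p :=
  FiberBundle.mdifferentiableAt_extend ..

theorem ext_self {p : M} (u : TangentSpace 𝓘(ℝ, E) p) : ext u p = u :=
  FiberBundle.extend_apply_self ..

/-- The map `(v, a) ↦ (g(v, ·) + a l, l(v) + a l2)` from `T_p M × ℝ` to its dual which is induced by
the bilinear form `A((v, a), (w, b)) = g(v, w) + a l(w) + b l(v) + a b l2`. -/
def amb (g : Π p : M, TangentSpace 𝓘(ℝ, E) p →L[ℝ] TangentSpace 𝓘(ℝ, E) p →L[ℝ] ℝ)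
    (l : Π p : M, TangentSpace 𝓘(ℝ, E) p →L[ℝ] ℝ) (l2 : M → ℝ) (p : M) :
    TangentSpace 𝓘(ℝ, E) p × ℝ →L[ℝ] (TangentSpace 𝓘(ℝ, E) p →L[ℝ] ℝ) × ℝ :=
  ContinuousLinearMap.prod
    ((g p).coprod (ContinuousLinearMap.toSpanSingleton ℝ (l p)))
    ((l p).coprod (ContinuousLinearMap.toSpanSingleton ℝ (l2 p)))

theorem exists_pair (h : Pre g l) (Y : VField E M) (p : M) (hY : MDiffAt (T% Y) p) :
    ∃ K : TangentSpace 𝓘(ℝ, E) p →L[ℝ] (TangentSpace 𝓘(ℝ, E) p →L[ℝ] ℝ) × ℝ,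
      ∀ X Z : VField E M, MDiffAt (T% X) p → MDiffAt (T% Z) p →
        (K (X p)).1 (Z p) = kos g Y p X Z ∧ (K (X p)).2 = kosl l Y p X := by
  refine ⟨ContinuousLinearMap.prod
    (TensorialAt.mkHom₂ (I := 𝓘(ℝ, E)) (F := E) (F' := E) (kos g Y p) p
      (fun Z hZ => kos_tens1 h hY hZ) (fun X hX => kos_tens2 h hY hX))
    (TensorialAt.mkHom (I := 𝓘(ℝ, E)) (F := E) (kosl l Y p) p (kosl_tens h hY)), ?_⟩
  intro X Z hX hZ
  refine ⟨?_, ?_⟩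
  · exact TensorialAt.mkHom₂_apply _ _ hX hZ
  · exact TensorialAt.mkHom_apply _ hX

open Classical in
/-- The Koszul expressions as a linear map in the direction of derivation. -/
def pair (h : Pre g l) (Y : VField E M) (p : M) :
    TangentSpace 𝓘(ℝ, E) p →L[ℝ] (TangentSpace 𝓘(ℝ, E) p →L[ℝ] ℝ) × ℝ :=
  if hY : MDiffAt (T% Y) p then (exists_pair h Y p hY).choose else 0

theorem pair_fst (h : Pre g l) {Y : VField E M} {p : M} (hY : MDiffAt (T% Y) p)
    (u w : TangentSpace 𝓘(ℝ, E) p) :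
    (pair h Y p u).1 w = kos g Y p (ext u) (ext w) := by
  have := (exists_pair h Y p hY).choose_spec (ext u) (ext w) (mdiff_ext u) (mdiff_ext w)
  rw [ext_self, ext_self] at this
  rw [pair, dif_pos hY, this.1]

theorem pair_snd (h : Pre g l) {Y : VField E M} {p : M} (hY : MDiffAt (T% Y) p)
    (u : TangentSpace 𝓘(ℝ, E) p) :
    (pair h Y p u).2 = kosl l Y p (ext u) := by
  have := (exists_pair h Y p hY).choose_spec (ext u) (ext u) (mdiff_ext u) (mdiff_ext u)
  rw [ext_self] at this
  rw [pair, dif_pos hY, this.2]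

theorem pair_add (h : Pre g l) {Y Y' : VField E M} {p : M} (hY : MDiffAt (T% Y) p)
    (hY' : MDiffAt (T% Y') p) : pair h (Y + Y') p = pair h Y p + pair h Y' p := by
  have hs : MDiffAt (T% (Y + Y')) p := mdifferentiableAt_add_section hY hY'
  ext u
  · rename_i w
    simp only [ContinuousLinearMap.add_apply, Prod.fst_add]
    rw [pair_fst h hs, pair_fst h hY, pair_fst h hY', kos_add h (mdiff_ext u) hY hY' (mdiff_ext w)]
  · simp only [ContinuousLinearMap.add_apply, Prod.snd_add]
    rw [pair_snd h hs, pair_snd h hY, pair_snd h hY', kosl_add h hY hY']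

theorem pair_leib (h : Pre g l) {f : M → ℝ} {Y : VField E M} {p : M} (hf : MDiffAt f p)
    (hY : MDiffAt (T% Y) p) (l2 : M → ℝ) (u : TangentSpace 𝓘(ℝ, E) p) :
    pair h (f • Y) p u = f p • pair h Y p u + dir f p u • amb g l l2 p (Y p, 0) := by
  have hs : MDiffAt (T% (f • Y)) p := hf.smul_section hY
  ext w
  · simp [amb]
    rw [pair_fst h hs, pair_fst h hY, kos_leib h hf (mdiff_ext u) hY (mdiff_ext w), ext_self,
      ext_self]
  · simp [amb]
    rw [pair_snd h hs, pair_snd h hY, kosl_leib h hf hY, ext_self]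

theorem exists_conn (h : Pre g l) (l2 : M → ℝ) (hA : ∀ p, (amb g l l2 p).IsInvertible) :
    ∃ (D : Connection E M) (b : VField E M → Tensor1 E M),
      ∀ (p : M) (Y : VField E M) (u : TangentSpace 𝓘(ℝ, E) p), MDiffAt (T% Y) p →
        amb g l l2 p (D Y p u, b Y p u) = pair h Y p u := by
  let A p := (hA p).choose
  have hA' : ∀ p x, (A p) x = amb g l l2 p x := fun p x => congr($((hA p).choose_spec) x)
  refine ⟨⟨fun Y p => (ContinuousLinearMap.fst ℝ (TangentSpace 𝓘(ℝ, E) p) ℝ ∘L ((A p).symm.toContinuousLinearMap)) ∘L pair h Y p,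
    ⟨?_, ?_⟩⟩,
    fun Y p u => ((A p).symm (pair h Y p u)).2, ?_⟩
  · intro Y Y' p hY hY' _
    simp only [pair_add h hY hY', ContinuousLinearMap.comp_add]
  · intro Y f p hY hf _
    ext u
    simp only [ContinuousLinearMap.comp_apply, pair_leib h hf hY l2, ← hA', map_add, map_smul,
      ContinuousLinearMap.add_apply, ContinuousLinearMap.smul_apply]
    simp [dir]
  · intro p Y u hY
    rw [← hA']
    simp
end
end Tensors

section Data
variable {E : Type*} [NormedAddCommGroup E] [NormedSpace ℝ E]
  {M : Type*} [TopologicalSpace M] [ChartedSpace E M] [IsManifold 𝓘(ℝ, E) ∞ M]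

variable (E M) in
/-- Metric hypersurface data `(M, γ, ℓ, ℓ2)`: a smooth symmetric 2-covariant tensor, a smooth covector
and a smooth function such that `A((W, a), (Z, b)) = γ(W, Z) + a ℓ(Z) + b ℓ(W) + a b ℓ2` is a
non-degenerate bilinear form on `T_p M × ℝ` for every `p`. No signature is prescribed. -/
structure MetricHypersurfaceData where
  γ : Π p : M, TangentSpace 𝓘(ℝ, E) p →L[ℝ] TangentSpace 𝓘(ℝ, E) p →L[ℝ] ℝ
  ell : Π p : M, TangentSpace 𝓘(ℝ, E) p →L[ℝ] ℝ
  ell2 : M → ℝ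
  γ_symm : ∀ p u w, γ p u w = γ p w u
  γ_smooth : ContMDiff 𝓘(ℝ, E) (𝓘(ℝ, E).prod 𝓘(ℝ, E →L[ℝ] E →L[ℝ] ℝ)) ∞
    (fun p => TotalSpace.mk' (E →L[ℝ] E →L[ℝ] ℝ)
      (E := fun p : M => TangentSpace 𝓘(ℝ, E) p →L[ℝ] TangentSpace 𝓘(ℝ, E) p →L[ℝ] ℝ) p (γ p))
  ell_smooth : ContMDiff 𝓘(ℝ, E) (𝓘(ℝ, E).prod 𝓘(ℝ, E →L[ℝ] ℝ)) ∞
    (fun p => TotalSpace.mk' (E →L[ℝ] ℝ)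
      (E := fun p : M => TangentSpace 𝓘(ℝ, E) p →L[ℝ] ℝ) p (ell p))
  ell2_smooth : ContMDiff 𝓘(ℝ, E) 𝓘(ℝ, ℝ) ∞ ell2
  nondegenerate : ∀ (p : M) (x : TangentSpace 𝓘(ℝ, E) p × ℝ),
    (∀ y : TangentSpace 𝓘(ℝ, E) p × ℝ,
      γ p x.1 y.1 + x.2 * ell p y.1 + y.2 * ell p x.1 + x.2 * y.2 * ell2 p = 0) → x = 0

variable [FiniteDimensional ℝ E] 

theorem amb_isInvertible (g : Π p : M, TangentSpace 𝓘(ℝ, E) p →L[ℝ] TangentSpace 𝓘(ℝ, E) p →L[ℝ] ℝ)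
    (l : Π p : M, TangentSpace 𝓘(ℝ, E) p →L[ℝ] ℝ) (l2 : M → ℝ) (p : M)
    (hinj : Function.Injective (amb g l l2 p)) : (amb g l l2 p).IsInvertible := by
  have : FiniteDimensional ℝ (TangentSpace 𝓘(ℝ, E) p) := inferInstanceAs (FiniteDimensional ℝ E)
  have : T2Space (TangentSpace 𝓘(ℝ, E) p) := inferInstanceAs (T2Space E)
  have hd : Module.finrank ℝ (TangentSpace 𝓘(ℝ, E) p × ℝ)
      = Module.finrank ℝ ((TangentSpace 𝓘(ℝ, E) p →L[ℝ] ℝ) × ℝ) := by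
    have : Module.finrank ℝ (TangentSpace 𝓘(ℝ, E) p →L[ℝ] ℝ)
        = Module.finrank ℝ (TangentSpace 𝓘(ℝ, E) p) := by
      rw [← LinearEquiv.finrank_eq (LinearMap.toContinuousLinearMap
        (𝕜 := ℝ) (E := TangentSpace 𝓘(ℝ, E) p) (F' := ℝ))]
      exact Subspace.dual_finrank_eq
    simp [this]
  let e : (TangentSpace 𝓘(ℝ, E) p × ℝ) ≃ₗ[ℝ] ((TangentSpace 𝓘(ℝ, E) p →L[ℝ] ℝ) × ℝ) :=
    LinearEquiv.ofInjectiveOfFinrankEq (amb g l l2 p).toLinearMap hinj hd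
  refine ⟨e.toContinuousLinearEquiv, ?_⟩
  ext x <;> rfl

namespace MetricHypersurfaceData
variable (D : MetricHypersurfaceData E M)

theorem amb_inj (p : M) : Function.Injective (amb D.γ D.ell D.ell2 p) := by
  rw [injective_iff_map_eq_zero]
  intro x hx
  apply D.nondegenerate p x
  intro y
  have h1 := congr($(congrArg Prod.fst hx) y.1)
  have h2 := congrArg Prod.snd hx
  simp [amb] at h1 h2
  linear_combination h1 + y.2 * h2

theorem amb_inv (p : M) : (amb D.γ D.ell D.ell2 p).IsInvertible :=
  amb_isInvertible _ _ _ p (D.amb_inj p)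

/-- The vector field `n` of the data: `(n, n2)` is the element of `T_p M × ℝ` with
`A((n, n2), (w, b)) = b` for all `(w, b)`, that is `γ(n, ·) + n2 ℓ = 0` and `ℓ(n) + n2 ℓ2 = 1`. -/
def n : VField E M := fun p => ((amb D.γ D.ell D.ell2 p).inverse (0, 1)).1

/-- The scalar `n2` (written `n^{(2)}`) of the data. -/
def n2 (p : M) : ℝ := ((amb D.γ D.ell D.ell2 p).inverse (0, 1)).2

theorem prod12 (p : M) : amb D.γ D.ell D.ell2 p (D.n p, D.n2 p) = (0, 1) :=
  (D.amb_inv p).self_apply_inverse _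

theorem prod1 (p : M) (w : TangentSpace 𝓘(ℝ, E) p) :
    D.γ p (D.n p) w + D.n2 p * D.ell p w = 0 := by
  have := congr($(congrArg Prod.fst (D.prod12 p)) w)
  simpa [amb] using this

theorem prod2 (p : M) : D.ell p (D.n p) + D.n2 p * D.ell2 p = 1 := by
  have := (congrArg Prod.snd (D.prod12 p))
  simpa [amb] using this

theorem pre : Pre D.γ D.ell where
  symm := D.γ_symm
  dg p X Y hX hY := by
    have h := (D.γ_smooth p).mdifferentiableAt (by simp)
    have := MDifferentiableAt.clm_bundle_apply₂ (b := fun q : M => q) (F₁ := E) (F₂ := E) (F₃ := ℝ)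
      (E₁ := (TangentSpace 𝓘(ℝ, E) : M → Type _)) (E₂ := (TangentSpace 𝓘(ℝ, E) : M → Type _))
      (E₃ := Bundle.Trivial M ℝ) h hX hY
    simp only [mdifferentiableAt_totalSpace] at this
    exact this.2
  dl p X hX := by
    have h := (D.ell_smooth p).mdifferentiableAt (by simp)
    have := MDifferentiableAt.clm_bundle_apply (b := fun q : M => q) (F₁ := E) (F₂ := ℝ)
      (E₁ := (TangentSpace 𝓘(ℝ, E) : M → Type _)) 
      (E₂ := Bundle.Trivial M ℝ) h hX
    simp only [mdifferentiableAt_totalSpace] at this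
    exact this.2

set_option synthInstance.maxHeartbeats 200000 in
set_option maxHeartbeats 1000000 in
theorem contMDiffAt_n (p : M) : 
   ContMDiffAt 𝓘(ℝ, E) (𝓘(ℝ, E).prod 𝓘(ℝ, E)) ∞ (fun q => TotalSpace.mk' E (E := (TangentSpace 𝓘(ℝ, E) : M → Type _)) q (D.n q)) p ∧
    ContMDiffAt 𝓘(ℝ, E) 𝓘(ℝ, ℝ) ∞ D.n2 p := by
  have hΓ := ((contMDiffAt_hom_bundle _).1 (D.γ_smooth p)).2
  have hΛ := ((contMDiffAt_hom_bundle _).1 (D.ell_smooth p)).2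
  set Γ : M → (E →L[ℝ] E →L[ℝ] ℝ) := fun q => ContinuousLinearMap.inCoordinates E
    (TangentSpace 𝓘(ℝ, E) : M → Type _) (E →L[ℝ] ℝ)
    (fun q : M => TangentSpace 𝓘(ℝ, E) q →L[ℝ] ℝ) p q p q (D.γ q) with hΓdef
  set Λ : M → (E →L[ℝ] ℝ) := fun q => ContinuousLinearMap.inCoordinates E
    (TangentSpace 𝓘(ℝ, E) : M → Type _) ℝ (fun q : M => ℝ) p q p q (D.ell q) with hΛdef
  have hΓ' : ContMDiffAt 𝓘(ℝ, E) 𝓘(ℝ, E →L[ℝ] E →L[ℝ] ℝ) ∞ Γ p := hΓ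
  have hΛ' : ContMDiffAt 𝓘(ℝ, E) 𝓘(ℝ, E →L[ℝ] ℝ) ∞ Λ p := hΛ
  let e := trivializationAt E (TangentSpace 𝓘(ℝ, E) : M → Type _) p
  have hpe : p ∈ e.baseSet := FiberBundle.mem_baseSet_trivializationAt' p
  have hΓe : ∀ q ∈ e.baseSet, ∀ v w, Γ q v w = D.γ q (e.symm q v) (e.symm q w) := by
    intro q hq v w
    have := inCoordinates_apply_eq₂ (𝕜 := ℝ) (F₁ := E) (F₂ := E) (F₃ := ℝ)
      (E₁ := (TangentSpace 𝓘(ℝ, E) : M → Type _)) (E₂ := (TangentSpace 𝓘(ℝ, E) : M → Type _))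
      (E₃ := Bundle.Trivial M ℝ) (x₀ := p) (x := q) (ϕ := D.γ q) (v := v) (w := w) hq hq (by simp)
    refine this.trans ?_
    rw [Trivialization.linearMapAt_apply]
    simp
    rfl
  have hΛe : ∀ q ∈ e.baseSet, ∀ v, Λ q v = D.ell q (e.symm q v) := by
    intro q hq v
    simp only [hΛdef]
    rw [ContinuousLinearMap.inCoordinates_eq (F' := ℝ) (E' := Bundle.Trivial M ℝ) hq
      (by simp)]
    simp [e]
  let T := E × ℝ →L[ℝ] (E →L[ℝ] ℝ) × ℝ
  let G₁ : M → T := fun q =>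
    ContinuousLinearMap.inl ℝ (E →L[ℝ] ℝ) ℝ ∘L Γ q ∘L ContinuousLinearMap.fst ℝ E ℝ
  let G₂ : M → T := fun q => ContinuousLinearMap.inl ℝ (E →L[ℝ] ℝ) ℝ ∘L
      (ContinuousLinearMap.smulRightL ℝ (E × ℝ) (E →L[ℝ] ℝ) (ContinuousLinearMap.snd ℝ E ℝ) (Λ q))
  let G₃ : M → T := fun q =>
    ContinuousLinearMap.inr ℝ (E →L[ℝ] ℝ) ℝ ∘L Λ q ∘L ContinuousLinearMap.fst ℝ E ℝ
  let G₄ : M → T := fun q =>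
    D.ell2 q • (ContinuousLinearMap.inr ℝ (E →L[ℝ] ℝ) ℝ ∘L ContinuousLinearMap.snd ℝ E ℝ)
  have c₁ : ContMDiffAt 𝓘(ℝ, E) 𝓘(ℝ, T) ∞ G₁ p :=
    contMDiffAt_const.clm_comp (hΓ'.clm_comp contMDiffAt_const)
  have c₂ : ContMDiffAt 𝓘(ℝ, E) 𝓘(ℝ, T) ∞ G₂ p :=
    contMDiffAt_const.clm_comp (contMDiffAt_const.clm_apply hΛ')
  have c₃ : ContMDiffAt 𝓘(ℝ, E) 𝓘(ℝ, T) ∞ G₃ p :=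
    contMDiffAt_const.clm_comp (hΛ'.clm_comp contMDiffAt_const)
  have c₄ : ContMDiffAt 𝓘(ℝ, E) 𝓘(ℝ, T) ∞ G₄ p :=
    (D.ell2_smooth p).smul contMDiffAt_const
  let G : M → T := G₁ + G₂ + G₃ + G₄
  have hG : ContMDiffAt 𝓘(ℝ, E) 𝓘(ℝ, T) ∞ G p := ((c₁.add c₂).add c₃).add c₄
  have hG1 : ∀ q x, (G q x).1 = Γ q x.1 + x.2 • Λ q := by
    intro q x
    change Γ q x.1 + x.2 • Λ q + 0 + D.ell2 q • 0 = _
    simp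
  have hG2 : ∀ q x, (G q x).2 = Λ q x.1 + x.2 * D.ell2 q := by
    intro q x
    change 0 + 0 + Λ q x.1 + D.ell2 q * x.2 = _
    ring
  have hsurj : ∀ q ∈ e.baseSet, ∀ w : TangentSpace 𝓘(ℝ, E) q, ∃ v, e.symm q v = w := by
    intro q hq w
    exact ⟨(e ⟨q, w⟩).2, by simp [e.symm_apply_apply_mk hq]⟩
  have hGA : ∀ q ∈ e.baseSet, ∀ v a, ∀ b : ℝ, G q (v, a) = (0, b) →
      amb D.γ D.ell D.ell2 q (e.symm q v, a) = (0, b) := by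
    intro q hq v a b h
    have h1 := congrArg Prod.fst h
    have h2 := congrArg Prod.snd h
    rw [hG1] at h1
    rw [hG2] at h2
    ext w
    · obtain ⟨w, rfl⟩ := hsurj q hq w
      have := congr($h1 w)
      simp [hΓe q hq, hΛe q hq] at this
      simp [amb, this]
    · simp [hΛe q hq] at h2
      simp [amb, h2]
  have hsymm0 : ∀ q ∈ e.baseSet, ∀ v, e.symm q v = 0 → v = 0 := by
    intro q hq v hv
    have h1 := congrArg Prod.snd (e.apply_mk_symm hq v)
    have h2 := congrArg Prod.snd (e.apply_mk_symm hq (0 : E))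
    have h3 : e.symm q (0 : E) = 0 := by
      rw [← e.coe_symmₗ (R := ℝ) hq]; exact map_zero (e.symmₗ ℝ q)
    rw [hv, ← h3] at h1
    exact h1.symm.trans h2
  have hGinj : ∀ q ∈ e.baseSet, Function.Injective (G q) := by
    intro q hq
    rw [injective_iff_map_eq_zero]
    rintro ⟨v, a⟩ h
    have := hGA q hq v a 0 h
    have := D.amb_inj q (this.trans (map_zero _).symm)
    simp only [Prod.mk_eq_zero] at this
    rw [hsymm0 q hq v this.1, this.2]
    rfl
  have hGinv : ∀ q ∈ e.baseSet, (G q).IsInvertible := by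
    intro q hq
    have hd : Module.finrank ℝ (E × ℝ) = Module.finrank ℝ ((E →L[ℝ] ℝ) × ℝ) := by
      have : Module.finrank ℝ (E →L[ℝ] ℝ) = Module.finrank ℝ E := by
        rw [← LinearEquiv.finrank_eq (LinearMap.toContinuousLinearMap
          (𝕜 := ℝ) (E := E) (F' := ℝ))]
        exact Subspace.dual_finrank_eq
      simp [this]
    let e' : (E × ℝ) ≃ₗ[ℝ] ((E →L[ℝ] ℝ) × ℝ) :=
      LinearEquiv.ofInjectiveOfFinrankEq (G q).toLinearMap (hGinj q hq) hd
    refine ⟨e'.toContinuousLinearEquiv, ?_⟩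
    ext x <;> rfl
  let N : M → E × ℝ := fun q => (G q).inverse (0, 1)
  have hN : ContMDiffAt 𝓘(ℝ, E) 𝓘(ℝ, E × ℝ) ∞ N p := by
    have h1 : ContMDiffAt 𝓘(ℝ, E) 𝓘(ℝ, (E →L[ℝ] ℝ) × ℝ →L[ℝ] E × ℝ) ∞
        (fun q => (G q).inverse) p :=
      ((hGinv p hpe).contDiffAt_map_inverse.contMDiffAt).comp p hG
    exact h1.clm_apply contMDiffAt_const
  have hkey : ∀ q ∈ e.baseSet, (D.n q, D.n2 q) = (e.symm q (N q).1, (N q).2) := by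
    intro q hq
    apply D.amb_inj q
    rw [D.prod12, hGA q hq (N q).1 (N q).2 1 ((hGinv q hq).self_apply_inverse _)]
  have hnhds : e.baseSet ∈ 𝓝 p := e.open_baseSet.mem_nhds hpe
  have hN1 : ContMDiffAt 𝓘(ℝ, E) 𝓘(ℝ, E) ∞ (fun q => (N q).1) p :=
    (contDiff_fst.contMDiff.contMDiffAt).comp p hN
  have hN2 : ContMDiffAt 𝓘(ℝ, E) 𝓘(ℝ, ℝ) ∞ (fun q => (N q).2) p :=
    (contDiff_snd.contMDiff.contMDiffAt).comp p hN
  refine ⟨?_, ?_⟩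
  · rw [contMDiffAt_section]
    refine hN1.congr_of_eventuallyEq ?_
    filter_upwards [hnhds] with q hq
    have := congrArg Prod.fst (hkey q hq)
    simp only at this
    rw [this]
    exact congrArg Prod.snd (e.apply_mk_symm hq _)
  · refine hN2.congr_of_eventuallyEq ?_
    filter_upwards [hnhds] with q hq
    exact (congrArg Prod.snd (hkey q hq) :)
end MetricHypersurfaceData
end Data

section Conn
variable {E : Type*} [NormedAddCommGroup E] [NormedSpace ℝ E]
  {M : Type*} [TopologicalSpace M] [ChartedSpace E M] [IsManifold 𝓘(ℝ, E) ∞ M]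
  [FiniteDimensional ℝ E]

theorem pair_gen {g : Π p : M, TangentSpace 𝓘(ℝ, E) p →L[ℝ] TangentSpace 𝓘(ℝ, E) p →L[ℝ] ℝ}
    {l : Π p : M, TangentSpace 𝓘(ℝ, E) p →L[ℝ] ℝ}
    (h : Pre g l) {Y : VField E M} {p : M} (hY : MDiffAt (T% Y) p) {X Z : VField E M}
    (hX : MDiffAt (T% X) p) (hZ : MDiffAt (T% Z) p) :
    (pair h Y p (X p)).1 (Z p) = kos g Y p X Z ∧ (pair h Y p (X p)).2 = kosl l Y p X := by
  rw [pair, dif_pos hY]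
  exact (exists_pair h Y p hY).choose_spec X Z hX hZ

theorem conn_torsion {g : Π p : M, TangentSpace 𝓘(ℝ, E) p →L[ℝ] TangentSpace 𝓘(ℝ, E) p →L[ℝ] ℝ}
    {l : Π p : M, TangentSpace 𝓘(ℝ, E) p →L[ℝ] ℝ} (h : Pre g l) (l2 : M → ℝ)
    (hA : ∀ p, (amb g l l2 p).IsInvertible) (D : Connection E M) (b : VField E M → Tensor1 E M)
    (hD : ∀ (p : M) (Y : VField E M) (u : TangentSpace 𝓘(ℝ, E) p), MDiffAt (T% Y) p →
        amb g l l2 p (D Y p u, b Y p u) = pair h Y p u) : D.torsion = 0 := by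
  ext p u w
  rw [CovariantDerivative.torsion_apply_eq_extend]
  have h1 := hD p (ext w) u (mdiff_ext w)
  have h2 := hD p (ext u) w (mdiff_ext u)
  have inj : Function.Injective (amb g l l2 p) := by
    obtain ⟨e, he⟩ := hA p
    rw [← he]; exact e.injective
  have key : amb g l l2 p (D (ext w) p u - D (ext u) p w - lieBr (ext u) (ext w) p,
      b (ext w) p u - b (ext u) p w) = 0 := by
    have e1 : (D (ext w) p u - D (ext u) p w - lieBr (ext u) (ext w) p,
      b (ext w) p u - b (ext u) p w) = (D (ext w) p u, b (ext w) p u)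
        - (D (ext u) p w, b (ext u) p w) - (lieBr (ext u) (ext w) p, (0 : ℝ)) := by
      ext <;> simp
    rw [e1, map_sub, map_sub, h1, h2]
    have a1 := fun z : TangentSpace 𝓘(ℝ, E) p =>
      pair_gen h (mdiff_ext w) (mdiff_ext u) (mdiff_ext z)
    have a2 := fun z : TangentSpace 𝓘(ℝ, E) p =>
      pair_gen h (mdiff_ext u) (mdiff_ext w) (mdiff_ext z)
    simp only [ext_self] at a1 a2
    ext z
    · simp only [Prod.fst_sub, ContinuousLinearMap.sub_apply, (a1 z).1, (a2 z).1]
      simp only [amb, kos, ext_self, lieBr_swap (ext w) (ext u), lieBr_swap (ext z) (ext u),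
        lieBr_swap (ext z) (ext w)]
      simp [h.symm _ (ext w _) (ext u _)]
      ring
    · simp only [Prod.snd_sub, (a1 0).2, (a2 0).2]
      simp only [amb, kosl, ext_self, lieBr_swap (ext w) (ext u)]
      simp
      ring
  have := inj (key.trans (map_zero _).symm)
  have h3 := congrArg Prod.fst this
  have eu : FiberBundle.extend E u p = u := FiberBundle.extend_apply_self ..
  have ew : FiberBundle.extend E w p = w := FiberBundle.extend_apply_self ..
  rw [eu, ew]
  exact h3

theorem conn_metric {g : Π p : M, TangentSpace 𝓘(ℝ, E) p →L[ℝ] TangentSpace 𝓘(ℝ, E) p →L[ℝ] ℝ}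
    {l : Π p : M, TangentSpace 𝓘(ℝ, E) p →L[ℝ] ℝ} (h : Pre g l) (l2 : M → ℝ)
    (D : Connection E M) (b : VField E M → Tensor1 E M)
    (hD : ∀ (p : M) (Y : VField E M) (u : TangentSpace 𝓘(ℝ, E) p), MDiffAt (T% Y) p →
        amb g l l2 p (D Y p u, b Y p u) = pair h Y p u)
    (p : M) (u v w : TangentSpace 𝓘(ℝ, E) p) :
    covDer2 D (fun q v w => g q v w) p u v w
      = b (ext v) p u * l p w + b (ext w) p u * l p v := by
  have h1 := hD p (ext w) u (mdiff_ext w)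
  have h2 := hD p (ext v) u (mdiff_ext v)
  have a1 := congr($(congrArg Prod.fst h1) v)
  have a2 := congr($(congrArg Prod.fst h2) w)
  rw [pair_fst h (mdiff_ext w)] at a1
  rw [pair_fst h (mdiff_ext v)] at a2
  simp only [amb, kos, ext_self] at a1 a2
  simp only [covDer2]
  rw [lieBr_swap (ext w) (ext u), lieBr_swap (ext w) (ext v)] at *
  rw [lieBr_swap (ext v) (ext u)] at *
  simp [h.symm _ (ext w _) (ext v _)] at a1 a2 ⊢
  have s1 := h.symm p v (lieBr (ext u) (ext w) p)
  have s2 := h.symm p w (lieBr (ext u) (ext v) p)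
  have s3 := h.symm p u (lieBr (ext v) (ext w) p)
  have s4 := h.symm p w (D (ext v) p u)
  have s5 := h.symm p v (D (ext w) p u)
  linarith

theorem conn_ell {g : Π p : M, TangentSpace 𝓘(ℝ, E) p →L[ℝ] TangentSpace 𝓘(ℝ, E) p →L[ℝ] ℝ}
    {l : Π p : M, TangentSpace 𝓘(ℝ, E) p →L[ℝ] ℝ} (h : Pre g l) (l2 : M → ℝ)
    (D : Connection E M) (b : VField E M → Tensor1 E M)
    (hD : ∀ (p : M) (Y : VField E M) (u : TangentSpace 𝓘(ℝ, E) p), MDiffAt (T% Y) p →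
        amb g l l2 p (D Y p u, b Y p u) = pair h Y p u)
    (p : M) (u w : TangentSpace 𝓘(ℝ, E) p) :
    covDer1 D (fun q v => l q v) p u w + covDer1 D (fun q v => l q v) p w u
      = (b (ext w) p u + b (ext u) p w) * l2 p := by
  have h1 := hD p (ext w) u (mdiff_ext w)
  have h2 := hD p (ext u) w (mdiff_ext u)
  have a1 := congrArg Prod.snd h1
  have a2 := congrArg Prod.snd h2
  rw [pair_snd h (mdiff_ext w)] at a1
  rw [pair_snd h (mdiff_ext u)] at a2
  simp only [amb, kosl, ext_self] at a1 a2
  simp only [covDer1]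
  rw [lieBr_swap (ext w) (ext u)] at *
  simp at a1 a2 ⊢
  linarith

namespace MetricHypersurfaceData
variable (D : MetricHypersurfaceData E M)

/-- `U = (1/2) £_n γ + ℓ ⊗_s d n2`, where `⊗_s` is the symmetrized tensor product (with a factor 1/2). -/
def U : Tensor2 E M := fun p u w =>
  (1/2) * lieDer D.n (fun q v w => D.γ q v w) p u w
    + (1/2) * (D.ell p u * dir D.n2 p w + D.ell p w * dir D.n2 p u)

theorem b_eq (C : Connection E M) (b : VField E M → Tensor1 E M)
    (hD : ∀ (p : M) (Y : VField E M) (u : TangentSpace 𝓘(ℝ, E) p), MDiffAt (T% Y) p →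
        amb D.γ D.ell D.ell2 p (C Y p u, b Y p u) = pair D.pre Y p u)
    (p : M) (u w : TangentSpace 𝓘(ℝ, E) p) : b (ext w) p u = - D.U p u w := by
  have hn : MDiffAt (T% D.n) p := (D.contMDiffAt_n p).1.mdifferentiableAt (by simp)
  have hn2 : MDiffAt D.n2 p := (D.contMDiffAt_n p).2.mdifferentiableAt (by simp)
  have h1 := hD p (ext w) u (mdiff_ext w)
  have g1 := pair_gen D.pre (mdiff_ext w) (mdiff_ext u) hn
  rw [ext_self, ← h1] at g1
  obtain ⟨g1, g2⟩ := g1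
  simp [amb] at g1 g2
  have p1 := D.prod1 p (C (ext w) p u)
  have p2 := D.prod2 p
  rw [D.γ_symm] at p1
  have key : b (ext w) p u = kos D.γ (ext w) p (ext u) D.n + D.n2 p * kosl D.ell (ext w) p (ext u) := by
    linear_combination -b (ext w) p u * p2 - p1 + g1 + D.n2 p * g2
  rw [key]
  have e : ∀ X : VField E M, (fun q => D.γ q (X q) (D.n q)) = fun q => (-D.n2 q) * D.ell q (X q) := by
    intro X; ext q
    have := D.prod1 q (X q)
    rw [D.γ_symm] at this
    linarith
  have hm : MDiffAt (fun q => -D.n2 q) p := hn2.neg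
  have hneg : ∀ v : TangentSpace 𝓘(ℝ, E) p, dir (fun q => - D.n2 q) p v = - dir D.n2 p v := by
    intro v
    have := mvfderiv_neg (I := 𝓘(ℝ, E)) (g := D.n2) (x := p)
    exact congr($this v)
  simp only [kos, kosl, e]
  rw [dir_mul _ hm (D.pre.dl p _ (mdiff_ext w)), dir_mul _ hm (D.pre.dl p _ (mdiff_ext u))]
  have p3 := D.prod1 p (lieBr (ext u) (ext w) p)
  rw [D.γ_symm] at p3
  simp only [hneg, U, lieDer, ext_self]
  rw [lieBr_swap (ext w) D.n, map_neg, D.γ_symm p u]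
  simp only [ContinuousLinearMap.neg_apply]
  rw [D.γ_symm p _ u] at *
  linear_combination (1/2) * p3

/-- The defining properties of the metric hypersurface connection: it is torsion-free and
`(∇_X γ)(Z, W) = - U(X, Z) ℓ(W) - U(X, W) ℓ(Z)`, `(∇_X ℓ)(Z) + (∇_Z ℓ)(X) = - 2 ℓ2 U(X, Z)`.
They determine the connection. -/
structure IsMetricHypersurfaceConnection (C : Connection E M) : Prop where
  torsion_eq_zero : C.torsion = 0
  covDer_γ : ∀ (p : M) (u v w : TangentSpace 𝓘(ℝ, E) p),
    covDer2 C (fun q x y => D.γ q x y) p u v w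
      = - D.U p u v * D.ell p w - D.U p u w * D.ell p v
  covDer_ell : ∀ (p : M) (u w : TangentSpace 𝓘(ℝ, E) p),
    covDer1 C (fun q x => D.ell q x) p u w + covDer1 C (fun q x => D.ell q x) p w u
      = - 2 * D.ell2 p * D.U p u w

theorem U_symm (p : M) (u w : TangentSpace 𝓘(ℝ, E) p) : D.U p u w = D.U p w u := by
  have e : (fun q => D.γ q (ext u q) (ext w q)) = fun q => D.γ q (ext w q) (ext u q) := by
    ext q; exact D.γ_symm ..
  simp only [U, lieDer, e, D.γ_symm p u, D.γ_symm p w]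
  ring

theorem exists_connection : ∃ C : Connection E M, D.IsMetricHypersurfaceConnection C := by
  obtain ⟨C, b, h⟩ := exists_conn D.pre D.ell2 D.amb_inv
  refine ⟨C, conn_torsion D.pre D.ell2 D.amb_inv C b h, ?_, ?_⟩
  · intro p u v w
    rw [conn_metric D.pre D.ell2 C b h, D.b_eq C b h, D.b_eq C b h]
    ring
  · intro p u w
    rw [conn_ell D.pre D.ell2 C b h, D.b_eq C b h, D.b_eq C b h, D.U_symm p w u]
    ring

end MetricHypersurfaceData
end Conn

section Hyp
variable {E : Type*} [NormedAddCommGroup E] [NormedSpace ℝ E] [FiniteDimensional ℝ E]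
  {M : Type*} [TopologicalSpace M] [ChartedSpace E M] [IsManifold 𝓘(ℝ, E) ∞ M]
  {E' : Type*} [NormedAddCommGroup E'] [NormedSpace ℝ E'] [FiniteDimensional ℝ E']
  {S : Type*} [TopologicalSpace S] [ChartedSpace E' S] [IsManifold 𝓘(ℝ, E') ∞ S]

namespace MetricHypersurfaceData
variable (D : MetricHypersurfaceData E M)

/-- `s = F(n, ·)` with `F = (1/2) dℓ`. -/
def s : Tensor1 E M := fun p w => (1/2) * extDer (fun q v => D.ell q v) p (D.n p) w

/-- The metric hypersurface connection. -/
def connection : Connection E M := D.exists_connection.choose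

/-- The tensor `Σ`, the Lie derivative along `n` of the metric hypersurface connection. -/
def Sigma (p : M) (u w : TangentSpace 𝓘(ℝ, E) p) : TangentSpace 𝓘(ℝ, E) p :=
  lieConn D.n D.connection p u w

end MetricHypersurfaceData

variable (E M) in
/-- Hypersurface data: metric hypersurface data with a smooth symmetric 2-covariant tensor `Y`. -/
structure HypersurfaceData extends MetricHypersurfaceData E M where
  Y : Π p : M, TangentSpace 𝓘(ℝ, E) p →L[ℝ] TangentSpace 𝓘(ℝ, E) p →L[ℝ] ℝ
  Y_symm : ∀ p u w, Y p u w = Y p w u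
  Y_smooth : ContMDiff 𝓘(ℝ, E) (𝓘(ℝ, E).prod 𝓘(ℝ, E →L[ℝ] E →L[ℝ] ℝ)) ∞
    (fun p => TotalSpace.mk' (E →L[ℝ] E →L[ℝ] ℝ)
      (E := fun p : M => TangentSpace 𝓘(ℝ, E) p →L[ℝ] TangentSpace 𝓘(ℝ, E) p →L[ℝ] ℝ) p (Y p))

variable (E M) in
/-- Null hypersurface data: the scalar `n2` vanishes everywhere. -/
structure NullHypersurfaceData extends HypersurfaceData E M where
  null : ∀ p, toMetricHypersurfaceData.n2 p = 0

variable (S E') in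
/-- A codimension one embedded submanifold `ψ : S → M` to which `n` is everywhere transverse. -/
structure TransverseSubmanifold (D : NullHypersurfaceData E M) where
  ψ : S → M
  isSmoothEmbedding : Manifold.IsSmoothEmbedding 𝓘(ℝ, E') 𝓘(ℝ, E) ∞ ψ
  codim_one : Module.finrank ℝ E = Module.finrank ℝ E' + 1
  transverse : ∀ p : S, D.n (ψ p) ∉ Set.range (mfderiv 𝓘(ℝ, E') 𝓘(ℝ, E) ψ p)

namespace TransverseSubmanifold
variable {D : NullHypersurfaceData E M} (Ψ : TransverseSubmanifold E' S D)

/-- The differential of the embedding. -/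
def dψ (p : S) : TangentSpace 𝓘(ℝ, E') p →L[ℝ] TangentSpace 𝓘(ℝ, E) (Ψ.ψ p) :=
  mfderiv 𝓘(ℝ, E') 𝓘(ℝ, E) Ψ.ψ p

/-- Pull-back of a covector to the submanifold. -/
def pull1 (T : Tensor1 E M) : Tensor1 E' S := fun p v => T (Ψ.ψ p) (Ψ.dψ p v)

/-- Pull-back of a 2-covariant tensor to the submanifold. -/
def pull2 (T : Tensor2 E M) : Tensor2 E' S := fun p v w => T (Ψ.ψ p) (Ψ.dψ p v) (Ψ.dψ p w)

/-- The induced metric `h = ψ^* γ`. -/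
def h (p : S) : TangentSpace 𝓘(ℝ, E') p →L[ℝ] TangentSpace 𝓘(ℝ, E') p →L[ℝ] ℝ :=
  ContinuousLinearMap.precomp ℝ (Ψ.dψ p) ∘L D.γ (Ψ.ψ p) ∘L Ψ.dψ p

theorem h_apply (p : S) (v w : TangentSpace 𝓘(ℝ, E') p) :
    Ψ.h p v w = D.γ (Ψ.ψ p) (Ψ.dψ p v) (Ψ.dψ p w) := rfl

theorem contMDiff_ψ : ContMDiff 𝓘(ℝ, E') 𝓘(ℝ, E) ∞ Ψ.ψ := Ψ.isSmoothEmbedding.contMDiff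

theorem dψ_injective (p : S) : Function.Injective (Ψ.dψ p) := by
  have hI := Ψ.isSmoothEmbedding.isImmersion.isImmersionAt p
  let g : M → S := fun y => hI.domChart.symm (hI.equiv.symm (hI.codChart y)).1
  have hval : ∀ x ∈ hI.domChart.source,
      (hI.equiv.symm (hI.codChart (Ψ.ψ x))).1 = hI.domChart x := by
    intro x hx
    have hm : hI.domChart x ∈ (hI.domChart.extend 𝓘(ℝ, E')).target := by
      simpa using hI.domChart.map_source hx
    have := hI.writtenInCharts hm
    simp [hI.domChart.left_inv hx] at this
    rw [this]
    simp
  have hg : ∀ x ∈ hI.domChart.source, g (Ψ.ψ x) = x := by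
    intro x hx
    simp only [g, hval x hx, hI.domChart.left_inv hx]
  have hgd : MDifferentiableAt 𝓘(ℝ, E) 𝓘(ℝ, E') g (Ψ.ψ p) := by
    have d1 : MDifferentiableAt 𝓘(ℝ, E) 𝓘(ℝ, E) hI.codChart (Ψ.ψ p) :=
      (contMDiffAt_of_mem_maximalAtlas hI.codChart_mem_maximalAtlas
        hI.mem_codChart_source).mdifferentiableAt (by simp)
    have d2 : MDifferentiableAt 𝓘(ℝ, E') 𝓘(ℝ, E') hI.domChart.symm (hI.domChart p) :=
      (contMDiffAt_symm_of_mem_maximalAtlas hI.domChart_mem_maximalAtlas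
        (hI.domChart.map_source hI.mem_domChart_source)).mdifferentiableAt (by simp)
    have d3 : MDifferentiableAt 𝓘(ℝ, E) 𝓘(ℝ, E') (fun y => (hI.equiv.symm y).1)
        (hI.codChart (Ψ.ψ p)) :=
      (((ContinuousLinearMap.fst ℝ E' hI.complement).comp
        (hI.equiv.symm : E →L[ℝ] E' × hI.complement)).differentiableAt).mdifferentiableAt
    have d4 := d3.comp (Ψ.ψ p) d1
    refine MDifferentiableAt.comp (Ψ.ψ p) (g := hI.domChart.symm) ?_ d4
    simp only [hval p hI.mem_domChart_source]
    exact d2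
  have hcomp : mfderiv 𝓘(ℝ, E') 𝓘(ℝ, E') (g ∘ Ψ.ψ) p = ContinuousLinearMap.id ℝ _ := by
    have : g ∘ Ψ.ψ =ᶠ[𝓝 p] id := by
      filter_upwards [hI.domChart.open_source.mem_nhds hI.mem_domChart_source] with x hx
      exact hg x hx
    rw [this.mfderiv_eq]
    exact mfderiv_id
  rw [mfderiv_comp p hgd (Ψ.contMDiff_ψ.mdifferentiableAt (by simp))] at hcomp
  intro v w hvw
  have e1 := congr($hcomp v)
  have e2 := congr($hcomp w)
  simp at e1 e2
  change Ψ.dψ p v = Ψ.dψ p w at hvw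
  change (mfderiv 𝓘(ℝ, E) 𝓘(ℝ, E') g (Ψ.ψ p)) (Ψ.dψ p v) = v at e1
  change (mfderiv 𝓘(ℝ, E) 𝓘(ℝ, E') g (Ψ.ψ p)) (Ψ.dψ p w) = w at e2
  rw [← e1, ← e2, hvw]

theorem exists_normal (p : S) : ∃ ν : TangentSpace 𝓘(ℝ, E) (Ψ.ψ p) →L[ℝ] ℝ,
    (∀ v, ν (Ψ.dψ p v) = 0) ∧ ν (D.n (Ψ.ψ p)) = 1 := by
  have : FiniteDimensional ℝ (TangentSpace 𝓘(ℝ, E) (Ψ.ψ p)) :=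
    inferInstanceAs (FiniteDimensional ℝ E)
  have : T2Space (TangentSpace 𝓘(ℝ, E) (Ψ.ψ p)) := inferInstanceAs (T2Space E)
  have hn : D.n (Ψ.ψ p) ∉ LinearMap.range (Ψ.dψ p).toLinearMap := by
    rintro ⟨v, hv⟩
    exact Ψ.transverse p ⟨v, hv⟩
  obtain ⟨f, hf, hle⟩ := Submodule.exists_le_ker_of_notMem hn
  refine ⟨LinearMap.toContinuousLinearMap ((f (D.n (Ψ.ψ p)))⁻¹ • f), ?_, ?_⟩
  · intro v
    have : f (Ψ.dψ p v) = 0 := hle ⟨v, rfl⟩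
    simp [this]
  · simp [hf]

theorem exists_decomp (p : S) (z : TangentSpace 𝓘(ℝ, E) (Ψ.ψ p)) :
    ∃ (w : TangentSpace 𝓘(ℝ, E') p) (c : ℝ), z = Ψ.dψ p w + c • D.n (Ψ.ψ p) := by
  let L : (TangentSpace 𝓘(ℝ, E') p × ℝ) →ₗ[ℝ] TangentSpace 𝓘(ℝ, E) (Ψ.ψ p) :=
    (Ψ.dψ p).toLinearMap.coprod (LinearMap.toSpanSingleton ℝ _ (D.n (Ψ.ψ p)))
  have hd : Module.finrank ℝ (TangentSpace 𝓘(ℝ, E') p × ℝ)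
      = Module.finrank ℝ (TangentSpace 𝓘(ℝ, E) (Ψ.ψ p)) := by
    have e := Ψ.codim_one
    have : FiniteDimensional ℝ (TangentSpace 𝓘(ℝ, E') p) :=
      inferInstanceAs (FiniteDimensional ℝ E')
    rw [Module.finrank_prod, Module.finrank_self]
    exact e.symm
  have : FiniteDimensional ℝ (TangentSpace 𝓘(ℝ, E) (Ψ.ψ p)) :=
    inferInstanceAs (FiniteDimensional ℝ E)
  have : FiniteDimensional ℝ (TangentSpace 𝓘(ℝ, E') p) :=
    inferInstanceAs (FiniteDimensional ℝ E')
  have hinj : Function.Injective L := by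
    obtain ⟨ν, h1, h2⟩ := Ψ.exists_normal p
    rw [injective_iff_map_eq_zero]
    rintro ⟨v, c⟩ hvc
    have hv : Ψ.dψ p v + c • D.n (Ψ.ψ p) = 0 := hvc
    have hc : c = 0 := by
      have := congrArg ν hv
      simpa [h1, h2] using this
    subst hc
    rw [zero_smul, add_zero] at hv
    rw [Ψ.dψ_injective p (hv.trans (map_zero _).symm)]
    rfl
  obtain ⟨⟨w, c⟩, hw⟩ := (LinearMap.injective_iff_surjective_of_finrank_eq_finrank hd).1 hinj z
  exact ⟨w, c, hw.symm⟩

theorem h_nondegenerate (p : S) (v : TangentSpace 𝓘(ℝ, E') p) (hv : ∀ w, Ψ.h p v w = 0) :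
    v = 0 := by
  have p1 := D.prod1 (Ψ.ψ p)
  have p2 := D.prod2 (Ψ.ψ p)
  simp only [D.null, zero_mul, add_zero] at p1 p2
  have hz : ∀ z, D.γ (Ψ.ψ p) (Ψ.dψ p v) z = 0 := by
    intro z
    obtain ⟨w, c, rfl⟩ := Ψ.exists_decomp p z
    have := hv w
    rw [h_apply] at this
    rw [map_add, map_smul, this, D.γ_symm _ _ (D.n _), p1]
    simp
  set a := D.ell (Ψ.ψ p) (Ψ.dψ p v) with ha
  have key := D.nondegenerate (Ψ.ψ p) (Ψ.dψ p v - a • D.n (Ψ.ψ p), 0) (by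
    intro y
    simp [hz, p1, p2, ← ha])
  have key : Ψ.dψ p v - a • D.n (Ψ.ψ p) = 0 := congrArg Prod.fst key
  obtain ⟨ν, h1, h2⟩ := Ψ.exists_normal p
  have ha0 : a = 0 := by
    have := congrArg ν key
    simpa [h1, h2] using this
  rw [ha0, zero_smul, sub_zero] at key
  exact Ψ.dψ_injective p (key.trans (map_zero _).symm)

theorem pre_h : Pre Ψ.h (fun _ => 0) where
  symm p v w := by rw [h_apply, h_apply, D.γ_symm]
  dg p X Y hX hY := by
    have hψ := Ψ.contMDiff_ψ
    have hmap : ∀ X : VField E' S, MDiffAt (T% X) p →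
        MDifferentiableAt 𝓘(ℝ, E') (𝓘(ℝ, E).prod 𝓘(ℝ, E)) (fun q => TotalSpace.mk' E
          (E := (TangentSpace 𝓘(ℝ, E) : M → Type _)) (Ψ.ψ q) (Ψ.dψ q (X q))) p := by
      intro X hX
      have h1 : ContMDiff 𝓘(ℝ, E').tangent 𝓘(ℝ, E).tangent ∞ (tangentMap 𝓘(ℝ, E') 𝓘(ℝ, E) Ψ.ψ) :=
        hψ.contMDiff_tangentMap (by simp)
      exact (h1.mdifferentiableAt (by simp)).comp p hX
    have hγ : MDifferentiableAt 𝓘(ℝ, E') (𝓘(ℝ, E).prod 𝓘(ℝ, E →L[ℝ] E →L[ℝ] ℝ))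
        (fun q => TotalSpace.mk' (E →L[ℝ] E →L[ℝ] ℝ)
        (E := fun p : M => TangentSpace 𝓘(ℝ, E) p →L[ℝ] TangentSpace 𝓘(ℝ, E) p →L[ℝ] ℝ)
        (Ψ.ψ q) (D.γ (Ψ.ψ q))) p :=
      ((D.γ_smooth _).mdifferentiableAt (by simp)).comp p (hψ.mdifferentiableAt (by simp))
    have := MDifferentiableAt.clm_bundle_apply₂ (b := Ψ.ψ) (F₁ := E) (F₂ := E) (F₃ := ℝ)
      (E₁ := (TangentSpace 𝓘(ℝ, E) : M → Type _)) (E₂ := (TangentSpace 𝓘(ℝ, E) : M → Type _))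
      (E₃ := Bundle.Trivial M ℝ) hγ (hmap X hX) (hmap Y hY)
    simp only [mdifferentiableAt_totalSpace] at this
    exact this.2
  dl p X hX := by
    simp only [ContinuousLinearMap.zero_apply]
    exact mdifferentiableAt_const

/-- The defining properties of the Levi-Civita connection of `h`. -/
structure IsLeviCivita (C : Connection E' S) : Prop where
  torsion_eq_zero : C.torsion = 0
  covDer_h : ∀ (p : S) (u v w : TangentSpace 𝓘(ℝ, E') p),
    covDer2 C (fun q x y => Ψ.h q x y) p u v w = 0

theorem exists_leviCivita : ∃ C : Connection E' S, Ψ.IsLeviCivita C := by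
  have hA : ∀ p, (amb Ψ.h (fun _ => 0) (fun _ => 1) p).IsInvertible := by
    intro p
    refine amb_isInvertible _ _ _ p ?_
    rw [injective_iff_map_eq_zero]
    rintro ⟨v, a⟩ hva
    have h1 := congrArg Prod.fst hva
    have h2 := congrArg Prod.snd hva
    simp [amb] at h1 h2
    rw [Ψ.h_nondegenerate p v (fun w => by rw [h1]; rfl), h2]
    rfl
  obtain ⟨C, b, h⟩ := exists_conn Ψ.pre_h (fun _ => 1) hA
  refine ⟨C, conn_torsion Ψ.pre_h _ hA C b h, ?_⟩
  intro p u v w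
  rw [conn_metric Ψ.pre_h _ C b h]
  simp

/-- The Levi-Civita connection of `h`. -/
def leviCivita : Connection E' S := Ψ.exists_leviCivita.choose

/-- The normal covector along the submanifold: it vanishes on the vectors tangent to it and
takes the value 1 on `n`. By transversality and codimension one it is unique. -/
def normal (p : S) : TangentSpace 𝓘(ℝ, E) (Ψ.ψ p) →L[ℝ] ℝ := (Ψ.exists_normal p).choose

/-- `ℓ_∥ = ψ^* ℓ`. -/
def ellPar (p : S) : TangentSpace 𝓘(ℝ, E') p →L[ℝ] ℝ := D.ell (Ψ.ψ p) ∘L Ψ.dψ p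

/-- The vector field `ℓ^♯_∥ = h^♯(ℓ_∥, ·)`, that is `h(ℓ^♯_∥, ·) = ℓ_∥`. -/
def ellSharp : VField E' S := fun p => (Ψ.h p).inverse (Ψ.ellPar p)

theorem h_ellSharp (p : S) : Ψ.h p (Ψ.ellSharp p) = Ψ.ellPar p := by
  have : FiniteDimensional ℝ (TangentSpace 𝓘(ℝ, E') p) :=
    inferInstanceAs (FiniteDimensional ℝ E')
  have : T2Space (TangentSpace 𝓘(ℝ, E') p) := inferInstanceAs (T2Space E')
  have hd : Module.finrank ℝ (TangentSpace 𝓘(ℝ, E') p)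
      = Module.finrank ℝ (TangentSpace 𝓘(ℝ, E') p →L[ℝ] ℝ) := by
    rw [← LinearEquiv.finrank_eq (LinearMap.toContinuousLinearMap
      (𝕜 := ℝ) (E := TangentSpace 𝓘(ℝ, E') p) (F' := ℝ))]
    exact Subspace.dual_finrank_eq.symm
  have hinj : Function.Injective (Ψ.h p) := by
    rw [injective_iff_map_eq_zero]
    intro v hv
    exact Ψ.h_nondegenerate p v (fun w => by rw [hv]; rfl)
  let e : (TangentSpace 𝓘(ℝ, E') p) ≃ₗ[ℝ] (TangentSpace 𝓘(ℝ, E') p →L[ℝ] ℝ) :=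
    LinearEquiv.ofInjectiveOfFinrankEq (Ψ.h p).toLinearMap hinj hd
  have hI : (Ψ.h p).IsInvertible := ⟨e.toContinuousLinearEquiv, by ext x; rfl⟩
  exact hI.self_apply_inverse _

/-- The scalar `h^♯(ℓ_∥, ℓ_∥)`. -/
def ell2Par (p : S) : ℝ := Ψ.ellPar p (Ψ.ellSharp p)

/-- The tensor `𝔖_∥` of the submanifold. In abstract index notation, with round brackets for
symmetrization, `𝔖_AB` is
`(£_n Y)_AB - (1/2) (ℓ2 - ℓ2_∥) (£_n U)_AB - 2 ∇^h_(A s_B)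
- ((1/2) n(ℓ2) + ℓ^C ℓ^D U_CD - 2 ℓ^C s_C) U_AB + ℓ^C (- ∇^h_C U_AB + 2 ∇^h_(A U_B)C)`. -/
def frakS : Tensor2 E' S := fun p v w =>
  Ψ.pull2 (lieDer D.n (fun q x y => D.Y q x y)) p v w
    - (1/2) * (D.ell2 (Ψ.ψ p) - Ψ.ell2Par p) * Ψ.pull2 (lieDer D.n D.U) p v w
    - (covDer1 Ψ.leviCivita (Ψ.pull1 D.s) p v w + covDer1 Ψ.leviCivita (Ψ.pull1 D.s) p w v)
    - ((1/2) * dir D.ell2 (Ψ.ψ p) (D.n (Ψ.ψ p))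
        + Ψ.pull2 D.U p (Ψ.ellSharp p) (Ψ.ellSharp p)
        - 2 * Ψ.pull1 D.s p (Ψ.ellSharp p)) * Ψ.pull2 D.U p v w
    + (- covDer2 Ψ.leviCivita (Ψ.pull2 D.U) p (Ψ.ellSharp p) v w
        + covDer2 Ψ.leviCivita (Ψ.pull2 D.U) p v w (Ψ.ellSharp p)
        + covDer2 Ψ.leviCivita (Ψ.pull2 D.U) p w v (Ψ.ellSharp p))

/-- The 2-covariant tensor `ψ^* (ν (Σ - n ⊗ £_n Y))` on the submanifold, `ν` being the normal
covector. -/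
def normalSigma : Tensor2 E' S := fun p v w =>
  Ψ.normal p (D.Sigma (Ψ.ψ p) (Ψ.dψ p v) (Ψ.dψ p w)
    - lieDer D.n (fun q x y => D.Y q x y) (Ψ.ψ p) (Ψ.dψ p v) (Ψ.dψ p w) • D.n (Ψ.ψ p))

end TransverseSubmanifold
end Hyp

end

end NullHyp

/-!
Write `∇` for the metric hypersurface connection and `Σ = £_n ∇`. The two equations defining `∇`
prescribe `∇γ` and the symmetric part of `∇ℓ` in terms of `U`, `ℓ` and `ℓ2`. Since `Σ` measures the
failure of `£_n` and `∇` to commute, taking the Lie derivative of these equations along `n`, with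
`£_n γ = 2 U` and `£_n ℓ = 2 s` for null data, determines `Σ` itself: the first gives the sum of
`γ(Σ(u, z), w)` and `γ(z, Σ(u, w))` (`γ_Sigma_add`), from which the permutation of arguments of the
Koszul formula isolates `γ(Σ(u, z), w)` (`γ_Sigma`), because `Σ` is symmetric (`Sigma_symm`); the
second gives `ℓ(Σ(u, w))` (`ell_Sigma`). Both right-hand sides involve only `£_n U`, `U`, `s`, `ℓ`,
`ℓ2`, the derivative `n(ℓ2)`, and the covariant derivatives `∇U`, `∇s`.

On the submanifold the normal covector is `ν = ℓ - γ(ℓ^♯_∥, ·)` (`normal_apply`), as both sides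
vanish on tangent vectors and take the value 1 on `n`. Hence `ν(Σ)` is known in terms of the
ambient derivatives `∇s` and `∇U`. For fields tangent to the submanifold the Koszul formulas of `∇`
and of the Levi-Civita connection of `h` yield the Gauss formula
`∇_u v = ∇^h_u v + U(u, v) ℓ^♯_∥` modulo `n` (`exists_connection_eq`). Since `U(n, ·) = 0` and
`s(n) = 0`, the multiple of `n` does not contribute, so `∇s` and `∇U` restrict to `∇^h s_∥` and
`∇^h U_∥` up to products of `U` with `U` or `s` (`covDer1_pull1`, `covDer2_pull2`).
Collecting terms gives `normalSigma_eq`, in which the derivative terms are those of `𝔖_∥` and the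
remaining ones are twice the corrections of the theorem.

The tensors are evaluated on tangent vectors through particular extensions to vector fields, which
brackets and covariant derivatives do not preserve. By tensoriality any differentiable extension
may be used (`lieDer_apply`, `covDer1_apply`, `covDer2_apply`). Second derivatives are commuted with
`dir_lieBr`, which needs `∇_X Y` to be smooth when `X` and `Y` are; this follows from the formulas
for `γ(∇_X Y, ·)` and `ℓ(∇_X Y)` and the non-degeneracy of the data
(`smoothFieldNear_of_pairing`, `smoothFieldNear_connection`).
-/

namespace NullHyp

section Smooth

variable {E : Type*} [NormedAddCommGroup E] [NormedSpace ℝ E]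
  {M : Type*} [TopologicalSpace M] [ChartedSpace E M] [IsManifold 𝓘(ℝ, E) ∞ M]

/-! ### Smooth functions, vector fields and tensors near a point -/

/-- The vector field `X` is smooth on a neighbourhood of `p`. (Being `C^∞` at the single point `p`
is weaker: it gives neighbourhoods on which `X` is `C^k` that may shrink with `k`.) -/
def SmoothFieldNear (X : VField E M) (p : M) : Prop :=
  ∀ᶠ q in 𝓝 p, CMDiffAt ∞ (T% X) q

variable (E) in
/-- The function `f` is smooth on a neighbourhood of `p`. -/
def SmoothNear (f : M → ℝ) (p : M) : Prop :=
  ∀ᶠ q in 𝓝 p, CMDiffAt ∞ f q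

variable {X Y : VField E M} {f g : M → ℝ} {p : M}

theorem SmoothFieldNear.eventually (h : SmoothFieldNear X p) :
    ∀ᶠ q in 𝓝 p, SmoothFieldNear X q :=
  Filter.Eventually.eventually_nhds h

theorem SmoothFieldNear.contMDiffAt (h : SmoothFieldNear X p) : CMDiffAt ∞ (T% X) p :=
  h.self_of_nhds

theorem SmoothFieldNear.mdiff (h : SmoothFieldNear X p) : MDiffAt (T% X) p :=
  h.contMDiffAt.mdifferentiableAt (by simp)

theorem SmoothNear.eventually (h : SmoothNear E f p) : ∀ᶠ q in 𝓝 p, SmoothNear E f q :=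
  Filter.Eventually.eventually_nhds h

theorem SmoothNear.contMDiffAt (h : SmoothNear E f p) : CMDiffAt ∞ f p := h.self_of_nhds

theorem SmoothNear.mdiff (h : SmoothNear E f p) : MDiffAt f p :=
  h.contMDiffAt.mdifferentiableAt (by simp)

theorem SmoothNear.congr (h : SmoothNear E f p) (hfg : ∀ᶠ q in 𝓝 p, g q = f q) :
    SmoothNear E g p := by
  filter_upwards [h, hfg.eventually_nhds] with q h1 h2
  exact h1.congr_of_eventuallyEq h2

theorem SmoothFieldNear.congr (h : SmoothFieldNear X p) (hXY : ∀ᶠ q in 𝓝 p, Y q = X q) :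
    SmoothFieldNear Y p := by
  filter_upwards [h, hXY.eventually_nhds] with q h1 h2
  refine h1.congr_of_eventuallyEq ?_
  filter_upwards [h2] with r hr
  rw [hr]

theorem SmoothNear.add (hf : SmoothNear E f p) (hg : SmoothNear E g p) :
    SmoothNear E (fun q => f q + g q) p := by
  filter_upwards [hf, hg] with q h1 h2 using h1.add h2

theorem SmoothNear.sub (hf : SmoothNear E f p) (hg : SmoothNear E g p) :
    SmoothNear E (fun q => f q - g q) p := by
  filter_upwards [hf, hg] with q h1 h2 using h1.sub h2

theorem SmoothNear.mul (hf : SmoothNear E f p) (hg : SmoothNear E g p) :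
    SmoothNear E (fun q => f q * g q) p := by
  filter_upwards [hf, hg] with q h1 h2 using ContMDiffAt.smul h1 h2

theorem SmoothNear.const (c : ℝ) : SmoothNear E (fun _ : M => c) p :=
  Filter.Eventually.of_forall fun _ => contMDiffAt_const

theorem smoothFieldNear_ext (u : TangentSpace 𝓘(ℝ, E) p) : SmoothFieldNear (ext u) p := by
  have hp := FiberBundle.mem_baseSet_trivializationAt' (F := E)
    (E := (TangentSpace 𝓘(ℝ, E) : M → Type _)) p
  filter_upwards [(trivializationAt E (TangentSpace 𝓘(ℝ, E)) p).open_baseSet.mem_nhds hp] with q hq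
  rw [Trivialization.contMDiffAt_section_iff _ hq]
  refine contMDiffAt_const (c := ((trivializationAt E (TangentSpace 𝓘(ℝ, E)) p) ⟨p, u⟩).2)
    |>.congr_of_eventuallyEq ?_
  filter_upwards [(trivializationAt E (TangentSpace 𝓘(ℝ, E)) p).open_baseSet.mem_nhds hq] with r hr
  have := congrArg Prod.snd ((trivializationAt E (TangentSpace 𝓘(ℝ, E)) p).apply_mk_symm hr
    ((trivializationAt E (TangentSpace 𝓘(ℝ, E)) p) ⟨p, u⟩).2)
  exact this

theorem SmoothFieldNear.lieBr [CompleteSpace E] (hX : SmoothFieldNear X p)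
    (hY : SmoothFieldNear Y p) :
    SmoothFieldNear (lieBr X Y) p := by
  filter_upwards [hX, hY] with q h1 h2
  have : IsManifold 𝓘(ℝ, E) (((⊤ : ℕ∞) : WithTop ℕ∞) + 1) M := by
    simpa using (inferInstance : IsManifold 𝓘(ℝ, E) ∞ M)
  have : IsManifold 𝓘(ℝ, E) (minSmoothness ℝ 2) M := by
    rw [minSmoothness_of_isRCLikeNormedField]; infer_instance
  exact ContMDiffAt.mlieBracket_vectorField (m := ⊤) (n := ⊤) h1 h2
    (by simp [minSmoothness_of_isRCLikeNormedField])

theorem SmoothNear.dir (hf : SmoothNear E f p) (hX : SmoothFieldNear X p) :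
    SmoothNear E (fun q => dir f q (X q)) p := by
  obtain ⟨U, hU, hUo, hpU⟩ := eventually_nhds_iff.1 hf
  filter_upwards [hX, hUo.mem_nhds hpU] with q h1 h2
  have hfU : CMDiff[U] ∞ f := fun r hr => (hU r hr).contMDiffWithinAt
  have ht := hfU.contMDiffOn_tangentMapWithin (m := ∞) (by simp) hUo.uniqueMDiffOn
  have ho : IsOpen (TotalSpace.proj ⁻¹' U : Set (TangentBundle 𝓘(ℝ, E) M)) :=
    hUo.preimage (FiberBundle.continuous_proj E _)
  have h3 := (ht.contMDiffAt (x := T% X q) (ho.mem_nhds h2)).comp q h1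
  have h4 := (contMDiff_snd_tangentBundle_modelSpace (n := ∞) ℝ 𝓘(ℝ, ℝ)).contMDiffAt.comp q h3
  refine h4.congr_of_eventuallyEq ?_
  filter_upwards [hUo.mem_nhds h2] with r hr
  change mfderiv 𝓘(ℝ, E) 𝓘(ℝ, ℝ) f r (X r) = mfderivWithin 𝓘(ℝ, E) 𝓘(ℝ, ℝ) f U r (X r)
  rw [mfderivWithin_of_isOpen hUo hr]

/-- Smooth covector fields, given as fields of functions on the tangent spaces. Smoothness is
tested on smooth vector fields. -/
structure SmoothTensor1 (α : Tensor1 E M) : Prop where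
  linear : ∀ p, IsLinearMap ℝ (α p)
  smooth : ∀ p X, SmoothFieldNear X p → SmoothNear E (fun q => α q (X q)) p

/-- Smooth 2-covariant tensors, given as fields of functions of two tangent vectors. Smoothness is
tested on smooth vector fields. -/
structure SmoothTensor2 (T : Tensor2 E M) : Prop where
  linear_left : ∀ p w, IsLinearMap ℝ (fun u => T p u w)
  linear_right : ∀ p u, IsLinearMap ℝ (T p u)
  smooth : ∀ p X Y, SmoothFieldNear X p → SmoothFieldNear Y p →
    SmoothNear E (fun q => T q (X q) (Y q)) p

variable [FiniteDimensional ℝ E]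

/-- Near `p` there is a frame of smooth vector fields `e`; the coefficients `c X` of a vector field
`X` are differentiable at `p` if `X` is. -/
theorem exists_frame (p : M) : ∃ (e : Fin (Module.finrank ℝ E) → VField E M)
    (c : VField E M → Fin (Module.finrank ℝ E) → M → ℝ),
    (∀ i, SmoothFieldNear (e i) p) ∧
    (∀ X, ∀ᶠ q in 𝓝 p, X q = ∑ i, c X i q • e i q) ∧
    (∀ X, MDiffAt (T% X) p → ∀ i, MDiffAt (c X i) p) ∧
    (∀ᶠ q in 𝓝 p, ∀ a : Fin (Module.finrank ℝ E) → ℝ, ∑ i, a i • e i q = 0 → a = 0) := by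
  let t := trivializationAt E (TangentSpace 𝓘(ℝ, E) : M → Type _) p
  let b := Module.finBasis ℝ E
  have hp : p ∈ t.baseSet := FiberBundle.mem_baseSet_trivializationAt' p
  refine ⟨t.localFrame b, fun X i q => t.localFrameCoeff 𝓘(ℝ, E) b i q (X q), ?_, ?_, ?_, ?_⟩
  · intro i
    filter_upwards [t.open_baseSet.mem_nhds hp] with q hq
    exact contMDiffAt_localFrame_of_mem ∞ t b i hq
  · intro X
    exact t.eventually_eq_localFrame_sum_coeff_smul b hp
  · intro X hX i
    exact mdifferentiableAt_localFrameCoeff b hp hX i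
  · filter_upwards [t.open_baseSet.mem_nhds hp] with q hq a ha
    have := (t.isLocalFrameOn_localFrame_baseSet 𝓘(ℝ, E) ∞ b).linearIndependent hq
    exact funext (Fintype.linearIndependent_iff.1 this a ha)

theorem mdiff_sum {ι : Type*} (s : Finset ι) {F : ι → M → ℝ} (h : ∀ i ∈ s, MDiffAt (F i) p) :
    MDiffAt (fun q => ∑ i ∈ s, F i q) p := by
  classical
  induction s using Finset.induction_on with
  | empty => simpa using mdifferentiableAt_const
  | insert a s ha ih =>
    simp only [Finset.sum_insert ha]
    exact (h a (by simp)).add (ih fun i hi => h i (by simp [hi]))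

theorem SmoothTensor1.mdiff {α : Tensor1 E M} (h : SmoothTensor1 α) (hX : MDiffAt (T% X) p) :
    MDiffAt (fun q => α q (X q)) p := by
  obtain ⟨e, c, he, hc, hd, -⟩ := exists_frame (E := E) p
  have key : ∀ᶠ q in 𝓝 p, α q (X q) = ∑ i, c X i q * α q (e i q) := by
    filter_upwards [hc X] with q hq
    conv_lhs => rw [hq]
    have := map_sum (h.linear q).mk' (fun i => c X i q • e i q) Finset.univ
    simp only [IsLinearMap.mk'_apply] at this
    rw [this]
    exact Finset.sum_congr rfl fun i _ => (h.linear q).map_smul _ _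
  refine MDifferentiableAt.congr_of_eventuallyEq ?_ key
  exact mdiff_sum _ fun i _ => (hd X hX i).mul (h.smooth p _ (he i)).mdiff

theorem SmoothTensor2.mdiff {T : Tensor2 E M} (h : SmoothTensor2 T) (hX : MDiffAt (T% X) p)
    (hY : MDiffAt (T% Y) p) : MDiffAt (fun q => T q (X q) (Y q)) p := by
  obtain ⟨e, c, he, hc, hd, -⟩ := exists_frame (E := E) p
  have key : ∀ᶠ q in 𝓝 p,
      T q (X q) (Y q) = ∑ i, ∑ j, c X i q * (c Y j q * T q (e i q) (e j q)) := by
    filter_upwards [hc X, hc Y] with q hX hY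
    conv_lhs => rw [hX, hY]
    have h1 := map_sum (h.linear_left q (∑ i, c Y i q • e i q)).mk' (fun i => c X i q • e i q)
      Finset.univ
    simp only [IsLinearMap.mk'_apply] at h1
    rw [h1]
    refine Finset.sum_congr rfl fun i _ => ?_
    have h2 := map_sum (h.linear_right q (c X i q • e i q)).mk' (fun i => c Y i q • e i q)
      Finset.univ
    simp only [IsLinearMap.mk'_apply] at h2
    rw [h2]
    refine Finset.sum_congr rfl fun j _ => ?_
    rw [(h.linear_right _ _).map_smul, (h.linear_left _ _).map_smul]
    simp only [smul_eq_mul]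
    ring
  refine MDifferentiableAt.congr_of_eventuallyEq ?_ key
  exact mdiff_sum _ fun i _ => mdiff_sum _ fun j _ =>
    (hd X hX i).mul ((hd Y hY j).mul (h.smooth p _ _ (he i) (he j)).mdiff)

end Smooth
end NullHyp

namespace NullHyp

section Fields

variable {E : Type*} [NormedAddCommGroup E] [NormedSpace ℝ E] [FiniteDimensional ℝ E]
  {M : Type*} [TopologicalSpace M] [ChartedSpace E M] [IsManifold 𝓘(ℝ, E) ∞ M]
  {p : M} {f g : M → ℝ} {T : Tensor2 E M} {α : Tensor1 E M} {X Y Z : VField E M}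

/-! ### Tensors evaluated on vector fields -/

theorem dir_sub (u : TangentSpace 𝓘(ℝ, E) p) (hf : MDiffAt f p) (hg : MDiffAt g p) :
    dir (fun q => f q - g q) p u = dir f p u - dir g p u := by
  have := mvfderiv_sub hf hg
  exact congr($this u)

theorem dir_const (c : ℝ) (u : TangentSpace 𝓘(ℝ, E) p) : dir (fun _ => c) p u = 0 := by
  have := mvfderiv_const (I := 𝓘(ℝ, E)) (x := p) c
  exact congr($this u)

theorem dir_const_mul (c : ℝ) (u : TangentSpace 𝓘(ℝ, E) p) (hf : MDiffAt f p) :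
    dir (fun q => c * f q) p u = c * dir f p u := by
  rw [dir_mul u mdifferentiableAt_const hf, dir_const, mul_zero, add_zero]

theorem dir_congr (h : ∀ᶠ q in 𝓝 p, f q = g q) (u : TangentSpace 𝓘(ℝ, E) p) :
    dir f p u = dir g p u := by
  have h' : f =ᶠ[𝓝 p] g := h
  have h1 := h'.mfderiv_eq (I := 𝓘(ℝ, E)) (I' := 𝓘(ℝ, ℝ))
  exact congr($h1 u)

variable {D : Connection E M}

theorem conn_smul (hf : MDiffAt f p) (hX : MDiffAt (T% X) p) (u : TangentSpace 𝓘(ℝ, E) p) :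
    D (f • X) p u = f p • D X p u + dir f p u • X p := by
  have := D.isCovariantDerivativeOnUniv.leibniz hX hf
  exact congr($this u)

theorem conn_add (hX : MDiffAt (T% X) p) (hY : MDiffAt (T% Y) p) (u : TangentSpace 𝓘(ℝ, E) p) :
    D (X + Y) p u = D X p u + D Y p u := by
  have := D.isCovariantDerivativeOnUniv.add hX hY
  exact congr($this u)

/-- A derivation at `p`, in the direction of the tangent vector `u`, of vector fields: an additive
operation obeying the Leibniz rule. Lie brackets with a fixed field and covariant derivatives
are the examples. -/
structure IsFieldDerivation (u : TangentSpace 𝓘(ℝ, E) p)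
    (δ : VField E M → TangentSpace 𝓘(ℝ, E) p) : Prop where
  add : ∀ {X Y : VField E M}, MDiffAt (T% X) p → MDiffAt (T% Y) p → δ (X + Y) = δ X + δ Y
  smul : ∀ {f : M → ℝ} {X : VField E M}, MDiffAt f p → MDiffAt (T% X) p →
    δ (f • X) = f p • δ X + dir f p u • X p

theorem isFieldDerivation_lieBr (Z : VField E M) (p : M) :
    IsFieldDerivation (Z p) (fun X => lieBr Z X p) :=
  ⟨lieBr_add_right, lieBr_smul_right⟩

theorem isFieldDerivation_conn (D : Connection E M) (u : TangentSpace 𝓘(ℝ, E) p) :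
    IsFieldDerivation u (fun X => D X p u) :=
  ⟨fun hX hY => conn_add hX hY u, fun hf hX => conn_smul hf hX u⟩

variable {u : TangentSpace 𝓘(ℝ, E) p} {δ : VField E M → TangentSpace 𝓘(ℝ, E) p}

/-- The derivation induced on covectors is again a covector. -/
theorem IsFieldDerivation.exists_linear (hδ : IsFieldDerivation u δ) (hα : SmoothTensor1 α) :
    ∃ B : TangentSpace 𝓘(ℝ, E) p →L[ℝ] ℝ, ∀ X : VField E M, MDiffAt (T% X) p →
      B (X p) = dir (fun q => α q (X q)) p u - α p (δ X) := by
  let Φ : VField E M → ℝ := fun X => dir (fun q => α q (X q)) p u - α p (δ X)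
  have hl := hα.linear
  refine ⟨TensorialAt.mkHom (I := 𝓘(ℝ, E)) (F := E) Φ p ⟨?_, ?_⟩,
    fun X hX => TensorialAt.mkHom_apply _ hX⟩
  · intro f X hf hX
    simp only [Φ, Pi.smul_apply', (hl _).map_smul, smul_eq_mul]
    rw [dir_mul _ hf (hα.mdiff hX), hδ.smul hf hX, (hl _).map_add,
      (hl _).map_smul, (hl _).map_smul]
    simp only [smul_eq_mul]
    ring
  · intro X X' hX hX'
    simp only [Φ, Pi.add_apply, (hl _).map_add]
    rw [dir_add _ (hα.mdiff hX) (hα.mdiff hX'), hδ.add hX hX', (hl _).map_add]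
    ring

/-- The derivation induced on 2-covariant tensors is again a 2-covariant tensor. -/
theorem IsFieldDerivation.exists_bilinear (hδ : IsFieldDerivation u δ) (hT : SmoothTensor2 T) :
    ∃ B : TangentSpace 𝓘(ℝ, E) p →L[ℝ] TangentSpace 𝓘(ℝ, E) p →L[ℝ] ℝ,
      ∀ X Y : VField E M, MDiffAt (T% X) p → MDiffAt (T% Y) p →
      B (X p) (Y p) = dir (fun q => T q (X q) (Y q)) p u - T p (δ X) (Y p) - T p (X p) (δ Y) := by
  let Φ : VField E M → VField E M → ℝ := fun X Y =>
    dir (fun q => T q (X q) (Y q)) p u - T p (δ X) (Y p) - T p (X p) (δ Y)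
  have hl := hT.linear_left
  have hr := hT.linear_right
  refine ⟨TensorialAt.mkHom₂ (I := 𝓘(ℝ, E)) (F := E) (F' := E) Φ p
    (fun Y hY => ⟨?_, ?_⟩) (fun X hX => ⟨?_, ?_⟩),
    fun X Y hX hY => TensorialAt.mkHom₂_apply _ _ hX hY⟩
  · intro f X hf hX
    simp only [Φ, Pi.smul_apply', (hl _ _).map_smul, smul_eq_mul]
    rw [dir_mul _ hf (hT.mdiff hX hY), hδ.smul hf hX, (hl _ _).map_add,
      (hl _ _).map_smul, (hl _ _).map_smul]
    simp only [smul_eq_mul]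
    ring
  · intro X X' hX hX'
    simp only [Φ, Pi.add_apply, (hl _ _).map_add]
    rw [dir_add _ (hT.mdiff hX hY) (hT.mdiff hX' hY), hδ.add hX hX', (hl _ _).map_add]
    ring
  · intro f Y hf hY
    simp only [Φ, Pi.smul_apply', (hr _ _).map_smul, smul_eq_mul]
    rw [dir_mul _ hf (hT.mdiff hX hY), hδ.smul hf hY, (hr _ _).map_add,
      (hr _ _).map_smul, (hr _ _).map_smul]
    simp only [smul_eq_mul]
    ring
  · intro Y Y' hY hY'
    simp only [Φ, Pi.add_apply, (hr _ _).map_add]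
    rw [dir_add _ (hT.mdiff hX hY) (hT.mdiff hX hY'), hδ.add hY hY', (hr _ _).map_add]
    ring

theorem exists_bilinear_lieDer (hT : SmoothTensor2 T) (Z : VField E M) (p : M) :
    ∃ B : TangentSpace 𝓘(ℝ, E) p →L[ℝ] TangentSpace 𝓘(ℝ, E) p →L[ℝ] ℝ,
      (∀ u w, lieDer Z T p u w = B u w) ∧
      ∀ X Y : VField E M, MDiffAt (T% X) p → MDiffAt (T% Y) p →
        B (X p) (Y p) = dir (fun q => T q (X q) (Y q)) p (Z p)
          - T p (lieBr Z X p) (Y p) - T p (X p) (lieBr Z Y p) := by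
  obtain ⟨B, hB⟩ := (isFieldDerivation_lieBr Z p).exists_bilinear hT
  refine ⟨B, fun u w => ?_, hB⟩
  have := hB _ _ (mdiff_ext u) (mdiff_ext w)
  simp only [ext_self] at this
  exact this.symm

/-- The Lie derivative of a 2-covariant tensor may be computed with arbitrary differentiable
extensions of the tangent vectors. -/
theorem lieDer_apply (hT : SmoothTensor2 T) (hX : MDiffAt (T% X) p) (hY : MDiffAt (T% Y) p) :
    lieDer Z T p (X p) (Y p) = dir (fun q => T q (X q) (Y q)) p (Z p)
      - T p (lieBr Z X p) (Y p) - T p (X p) (lieBr Z Y p) := by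
  obtain ⟨B, h1, h2⟩ := exists_bilinear_lieDer hT Z p
  rw [h1, h2 X Y hX hY]

/-- The Lie derivative of a smooth 2-covariant tensor along a smooth vector field is smooth. -/
theorem SmoothTensor2.lieDer (hT : SmoothTensor2 T) (hZ : ∀ p, SmoothFieldNear Z p) :
    SmoothTensor2 (lieDer Z T) := by
  refine ⟨fun p w => ?_, fun p u => ?_, fun p X Y hX hY => ?_⟩
  · obtain ⟨B, h1, -⟩ := exists_bilinear_lieDer hT Z p
    exact ⟨fun u u' => by simp [h1], fun c u => by simp [h1]⟩
  · obtain ⟨B, h1, -⟩ := exists_bilinear_lieDer hT Z p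
    exact ⟨fun u u' => by simp [h1], fun c u => by simp [h1]⟩
  · refine ((((hT.smooth p X Y hX hY).dir (hZ p)).sub
      (hT.smooth p _ Y ((hZ p).lieBr hX) hY)).sub
      (hT.smooth p X _ hX ((hZ p).lieBr hY))).congr ?_
    filter_upwards [hX.eventually, hY.eventually] with q h1 h2
    exact lieDer_apply hT h1.mdiff h2.mdiff

theorem covDer1_apply (hα : SmoothTensor1 α) (u : TangentSpace 𝓘(ℝ, E) p)
    (hX : MDiffAt (T% X) p) :
    covDer1 D α p u (X p) = dir (fun q => α q (X q)) p u - α p (D X p u) := by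
  obtain ⟨B, hB⟩ := (isFieldDerivation_conn D u).exists_linear hα
  have h := hB _ (mdiff_ext (X p))
  rw [ext_self] at h
  rw [← hB X hX, h]
  rfl

theorem covDer2_apply (hT : SmoothTensor2 T) (u : TangentSpace 𝓘(ℝ, E) p)
    (hX : MDiffAt (T% X) p) (hY : MDiffAt (T% Y) p) :
    covDer2 D T p u (X p) (Y p) = dir (fun q => T q (X q) (Y q)) p u
      - T p (D X p u) (Y p) - T p (X p) (D Y p u) := by
  obtain ⟨B, hB⟩ := (isFieldDerivation_conn D u).exists_bilinear hT
  have h := hB _ _ (mdiff_ext (X p)) (mdiff_ext (Y p))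
  simp only [ext_self] at h
  rw [← hB X Y hX hY, h]
  rfl

/-- In the first argument of an exterior derivative the tangent vector may be extended to an
arbitrary differentiable field. -/
theorem extDer_apply_left (hα : SmoothTensor1 α) (hX : MDiffAt (T% X) p)
    (w : TangentSpace 𝓘(ℝ, E) p) :
    extDer α p (X p) w = dir (fun q => α q (ext w q)) p (X p)
      - dir (fun q => α q (X q)) p w - α p (lieBr X (ext w) p) := by
  let Φ : VField E M → ℝ := fun X => dir (fun q => α q (ext w q)) p (X p)
      - dir (fun q => α q (X q)) p w - α p (lieBr X (ext w) p)
  have hl := hα.linear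
  have h := TensorialAt.pointwise (I := 𝓘(ℝ, E)) (F := E) (Φ := Φ)
    (x := p) ⟨?_, ?_⟩ (mdiff_ext (X p)) hX (ext_self _)
  · simp only [Φ, ext_self] at h
    exact h
  · intro f X hf hX
    simp only [Φ, Pi.smul_apply', (hl _).map_smul, smul_eq_mul, map_smul]
    rw [dir_mul _ hf (hα.mdiff hX), lieBr_smul_left hf hX, (hl _).map_sub,
      (hl _).map_smul, (hl _).map_smul, ext_self]
    simp only [smul_eq_mul]
    ring
  · intro X X' hX hX'
    simp only [Φ, Pi.add_apply, (hl _).map_add, map_add]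
    rw [dir_add _ (hα.mdiff hX) (hα.mdiff hX'), lieBr_add_left hX hX', (hl _).map_add]
    ring

end Fields
end NullHyp

namespace NullHyp

section Bracket

variable {E : Type*} [NormedAddCommGroup E] [NormedSpace ℝ E] [FiniteDimensional ℝ E]
  {M : Type*} [TopologicalSpace M] [ChartedSpace E M] [IsManifold 𝓘(ℝ, E) ∞ M]
  {p : M} {f : M → ℝ} {X Y Z : VField E M}

/-! ### Lie brackets as commutators of derivations -/

/-- The Lie bracket acts on functions as a commutator, in a vector space: the second derivative
of `F` is symmetric. -/
theorem fderiv_apply_comm_sub {F : E → ℝ} {V W : E → E} {x : E} (hF : ContDiffAt ℝ 2 F x)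
    (hV : DifferentiableAt ℝ V x) (hW : DifferentiableAt ℝ W x) :
    fderiv ℝ F x (fderiv ℝ W x (V x) - fderiv ℝ V x (W x))
      = fderiv ℝ (fun y => fderiv ℝ F y (W y)) x (V x)
        - fderiv ℝ (fun y => fderiv ℝ F y (V y)) x (W x) := by
  have hd : DifferentiableAt ℝ (fderiv ℝ F) x :=
    (hF.fderiv_right (m := 1) (by norm_num)).differentiableAt (by simp)
  rw [fderiv_clm_apply hd hW, fderiv_clm_apply hd hV]
  have hs := (hF.isSymmSndFDerivAt (by simp)).eq (V x) (W x)
  simp [hs]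

/-- The vector field `X` read in the chart at `p`. -/
noncomputable def chartRepr (X : VField E M) (p : M) : E → E :=
  mpullbackWithin 𝓘(ℝ, E) 𝓘(ℝ, E) (extChartAt 𝓘(ℝ, E) p).symm X (Set.range 𝓘(ℝ, E))

theorem differentiableAt_chartRepr (hX : MDiffAt (T% X) p) :
    DifferentiableAt ℝ (chartRepr X p) (extChartAt 𝓘(ℝ, E) p p) := by
  have := (mdifferentiableWithinAt_univ.2
    hX).differentiableWithinAt_mpullbackWithin_vectorField
  rw [Set.preimage_univ, Set.univ_inter] at this
  exact this.differentiableAt (by simp)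

theorem eventually_mfderiv_extChartAt_apply (X : VField E M) (p : M) :
    ∀ᶠ q in 𝓝 p, mfderiv 𝓘(ℝ, E) 𝓘(ℝ, E) (extChartAt 𝓘(ℝ, E) p) q (X q)
      = chartRepr X p (extChartAt 𝓘(ℝ, E) p q) := by
  have h := eventuallyEq_mpullback_mpullbackWithin_extChartAt (I := 𝓘(ℝ, E)) (s := Set.univ)
    (x := p) X
  rw [nhdsWithin_univ] at h
  filter_upwards [h, extChartAt_source_mem_nhds (I := 𝓘(ℝ, E)) p] with q hq hs
  rw [hq, mpullback_apply]
  exact (isInvertible_mfderiv_extChartAt hs).self_apply_inverse _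

theorem mfderiv_extChartAt_lieBr (hX : MDiffAt (T% X) p) (hY : MDiffAt (T% Y) p) :
    mfderiv 𝓘(ℝ, E) 𝓘(ℝ, E) (extChartAt 𝓘(ℝ, E) p) p (lieBr X Y p)
      = fderiv ℝ (chartRepr Y p) (extChartAt 𝓘(ℝ, E) p p)
          (chartRepr X p (extChartAt 𝓘(ℝ, E) p p))
        - fderiv ℝ (chartRepr X p) (extChartAt 𝓘(ℝ, E) p p)
          (chartRepr Y p (extChartAt 𝓘(ℝ, E) p p)) := by
  refine ((isInvertible_mfderiv_extChartAt (mem_extChartAt_source p)).self_apply_inverse _).trans ?_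
  have := lieBracketWithin_eq_lieBracket (uniqueDiffWithinAt_univ (𝕜 := ℝ))
    (differentiableAt_chartRepr hX) (differentiableAt_chartRepr hY)
  rw [lieBracket_eq] at this
  refine Eq.trans ?_ this
  rw [Set.preimage_univ, Set.univ_inter]
  congr 1
  exact 𝓘(ℝ, E).range_eq_univ

theorem dir_comp_extChartAt {F : E → ℝ} {q : M} (hq : q ∈ (extChartAt 𝓘(ℝ, E) p).source)
    (hF : DifferentiableAt ℝ F (extChartAt 𝓘(ℝ, E) p q)) (v : TangentSpace 𝓘(ℝ, E) q) :
    dir (fun r => F (extChartAt 𝓘(ℝ, E) p r)) q v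
      = fderiv ℝ F (extChartAt 𝓘(ℝ, E) p q)
        (mfderiv 𝓘(ℝ, E) 𝓘(ℝ, E) (extChartAt 𝓘(ℝ, E) p) q v) := by
  rw [extChartAt_source] at hq
  have := mvfderiv_comp_apply (I := 𝓘(ℝ, E)) (I' := 𝓘(ℝ, E)) q hF.mdifferentiableAt
    (mdifferentiableAt_extChartAt hq) v
  refine this.trans ?_
  simp only [mvfderiv, mfderiv_eq_fderiv]
  rfl

/-- A Lie bracket acts on functions as a commutator. -/
theorem dir_lieBr (hf : SmoothNear E f p) (hX : SmoothFieldNear X p) (hY : SmoothFieldNear Y p) :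
    dir f p (lieBr X Y p)
      = dir (fun q => dir f q (Y q)) p (X p) - dir (fun q => dir f q (X q)) p (Y p) := by
  -- the function read in the chart at `p`, where the claim is `fderiv_apply_comm_sub`
  let F : E → ℝ := fun y => f ((extChartAt 𝓘(ℝ, E) p).symm y)
  have hs := extChartAt_source_mem_nhds (I := 𝓘(ℝ, E)) p
  have hfF : ∀ q ∈ (extChartAt 𝓘(ℝ, E) p).source, f q = F (extChartAt 𝓘(ℝ, E) p q) :=
    fun q hq => by simp only [F, (extChartAt 𝓘(ℝ, E) p).left_inv hq]
  have hFs : ∀ q ∈ (extChartAt 𝓘(ℝ, E) p).source,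
    ContMDiffAt 𝓘(ℝ, E) 𝓘(ℝ, ℝ) ∞ f q → ContDiffAt ℝ ∞ F (extChartAt 𝓘(ℝ, E) p q) := by
    intro q hq h
    rw [← contMDiffAt_iff_contDiffAt]
    have h2 : ContMDiffAt 𝓘(ℝ, E) 𝓘(ℝ, E) ∞ (extChartAt 𝓘(ℝ, E) p).symm
        (extChartAt 𝓘(ℝ, E) p q) := by
      have := contMDiffOn_extChartAt_symm (I := 𝓘(ℝ, E)) (n := ∞) p
      exact this.contMDiffAt ((isOpen_extChartAt_target (I := 𝓘(ℝ, E)) p).mem_nhds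
        ((extChartAt 𝓘(ℝ, E) p).map_source hq))
    refine ContMDiffAt.comp (extChartAt 𝓘(ℝ, E) p q) (g := f) ?_ h2
    rwa [(extChartAt 𝓘(ℝ, E) p).left_inv hq]
  have hd : ∀ Z : VField E M, ∀ᶠ q in 𝓝 p, dir f q (Z q)
      = (fun y => fderiv ℝ F y (chartRepr Z p y)) (extChartAt 𝓘(ℝ, E) p q) := by
    intro Z
    filter_upwards [hf,
      (isOpen_extChartAt_source (I := 𝓘(ℝ, E)) p).mem_nhds (mem_extChartAt_source p),
      eventually_mfderiv_extChartAt_apply Z p] with q h1 h2 h3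
    have : ∀ᶠ r in 𝓝 q, f r = F (extChartAt 𝓘(ℝ, E) p r) := by
      filter_upwards [(isOpen_extChartAt_source (I := 𝓘(ℝ, E)) p).mem_nhds h2] with r hr
      exact hfF r hr
    rw [dir_congr this, dir_comp_extChartAt h2 ((hFs q h2 h1).differentiableAt (by simp)), h3]
  have hp := mem_extChartAt_source (I := 𝓘(ℝ, E)) p
  have hF := hFs p hp hf.self_of_nhds
  have hdd : ∀ Z W : VField E M, MDiffAt (T% Z) p → dir (fun q => dir f q (Z q)) p (W p)
      = fderiv ℝ (fun y => fderiv ℝ F y (chartRepr Z p y)) (extChartAt 𝓘(ℝ, E) p p)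
        (chartRepr W p (extChartAt 𝓘(ℝ, E) p p)) := by
    intro Z W hZ
    rw [dir_congr (hd Z), dir_comp_extChartAt
      (F := fun y => fderiv ℝ F y (chartRepr Z p y)) hp,
      (eventually_mfderiv_extChartAt_apply W p).self_of_nhds]
    exact ((hF.fderiv_right (m := 1) (by norm_cast)).differentiableAt
      (by simp)).clm_apply (differentiableAt_chartRepr hZ)
  have hfp : ∀ᶠ r in 𝓝 p, f r = F (extChartAt 𝓘(ℝ, E) p r) := Filter.eventually_of_mem hs hfF
  rw [hdd Y X hY.mdiff, hdd X Y hX.mdiff, dir_congr hfp,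
    dir_comp_extChartAt hp (hF.differentiableAt (by simp)),
    mfderiv_extChartAt_lieBr hX.mdiff hY.mdiff]
  exact fderiv_apply_comm_sub (hF.of_le (by norm_cast))
    (differentiableAt_chartRepr hX.mdiff) (differentiableAt_chartRepr hY.mdiff)

/-- The Jacobi identity. -/
theorem lieBr_leibniz (hX : SmoothFieldNear X p) (hY : SmoothFieldNear Y p)
    (hZ : SmoothFieldNear Z p) :
    lieBr X (lieBr Y Z) p = lieBr (lieBr X Y) Z p + lieBr Y (lieBr X Z) p := by
  have : IsManifold 𝓘(ℝ, E) (minSmoothness ℝ 3) M := by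
    rw [minSmoothness_of_isRCLikeNormedField]
    exact IsManifold.of_le (n := ∞) (by norm_cast)
  have h : ∀ {W : VField E M}, SmoothFieldNear W p → CMDiffAt (minSmoothness ℝ 2) (T% W) p := by
    intro W hW
    rw [minSmoothness_of_isRCLikeNormedField]
    exact hW.contMDiffAt.of_le (by norm_cast)
  exact leibniz_identity_mlieBracket_apply (h hX) (h hY) (h hZ)

end Bracket
end NullHyp

namespace NullHyp
namespace MetricHypersurfaceData

variable {E : Type*} [NormedAddCommGroup E] [NormedSpace ℝ E] [FiniteDimensional ℝ E]
  {M : Type*} [TopologicalSpace M] [ChartedSpace E M] [IsManifold 𝓘(ℝ, E) ∞ M]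
  (D : MetricHypersurfaceData E M) {p : M} {X Y Z V : VField E M}

/-! ### Smoothness of the tensors and of the connection of the data -/

theorem smoothTensor_γ : SmoothTensor2 (fun q x y => D.γ q x y) where
  linear_left p w := ⟨by simp, by simp⟩
  linear_right p w := ⟨by simp, by simp⟩
  smooth p X Y hX hY := by
    filter_upwards [hX, hY] with q h1 h2
    have := ContMDiffAt.clm_bundle_apply₂ (b := fun q : M => q) (F₁ := E) (F₂ := E) (F₃ := ℝ)
      (E₁ := (TangentSpace 𝓘(ℝ, E) : M → Type _)) (E₂ := (TangentSpace 𝓘(ℝ, E) : M → Type _))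
      (E₃ := Bundle.Trivial M ℝ) (D.γ_smooth q) h1 h2
    simp only [contMDiffAt_totalSpace] at this
    exact this.2

theorem smoothTensor_ell : SmoothTensor1 (fun q x => D.ell q x) where
  linear p := ⟨by simp, by simp⟩
  smooth p X hX := by
    filter_upwards [hX] with q h1
    have := ContMDiffAt.clm_bundle_apply (b := fun q : M => q) (F₁ := E) (F₂ := ℝ)
      (E₁ := (TangentSpace 𝓘(ℝ, E) : M → Type _))
      (E₂ := Bundle.Trivial M ℝ) (D.ell_smooth q) h1
    simp only [contMDiffAt_totalSpace] at this
    exact this.2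

theorem smoothNear_ell2 (p : M) : SmoothNear E D.ell2 p :=
  Filter.Eventually.of_forall fun q => D.ell2_smooth q

theorem smoothFieldNear_n (p : M) : SmoothFieldNear D.n p :=
  Filter.Eventually.of_forall fun q => (D.contMDiffAt_n q).1

/-- A vector field is smooth if its products with `γ` and `ℓ` are. -/
theorem smoothFieldNear_of_pairing
    (hγ : ∀ Z : VField E M, SmoothFieldNear Z p → SmoothNear E (fun q => D.γ q (V q) (Z q)) p)
    (hℓ : SmoothNear E (fun q => D.ell q (V q)) p) : SmoothFieldNear V p := by
  obtain ⟨e, c, he, hc, -, hind⟩ := exists_frame (E := E) p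
  let ι := Fin (Module.finrank ℝ E)
  -- the products of the frame fields with `γ` and `ℓ`; the map `B` they define on coefficient
  -- vectors is injective at `p` by non-degeneracy
  let g : ι → M → (ι → ℝ) × ℝ := fun i q => (fun j => D.γ q (e i q) (e j q), D.ell q (e i q))
  let B : (ι → ℝ) →ₗ[ℝ] (ι → ℝ) × ℝ := ∑ i, (LinearMap.proj i).smulRight (g i p)
  have hB : ∀ a, B a = ∑ i, a i • g i p := fun a => by simp [B]
  have hpair : ∀ q (a : ι → ℝ), ∑ i, a i • g i q
      = (fun j => D.γ q (∑ i, a i • e i q) (e j q), D.ell q (∑ i, a i • e i q)) := by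
    intro q a
    ext j
    · simp [g, Prod.fst_sum]
    · simp [g, Prod.snd_sum]
  have hinj : Function.Injective B := by
    rw [injective_iff_map_eq_zero]
    intro a ha
    rw [hB, hpair, Prod.mk_eq_zero] at ha
    refine hind.self_of_nhds a ?_
    have h0 := D.nondegenerate p (∑ i, a i • e i p, 0) (by
      intro y
      have h2 := (hc (ext y.1)).self_of_nhds
      rw [ext_self] at h2
      have h3 : D.γ p (∑ i, a i • e i p) y.1 = 0 := by
        rw [h2, map_sum]
        refine Finset.sum_eq_zero fun j _ => ?_
        rw [map_smul, congrFun ha.1 j]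
        simp
      simp only [h3, ha.2]
      ring)
    exact congrArg Prod.fst h0
  obtain ⟨R', hR'⟩ := B.exists_leftInverse_of_injective (LinearMap.ker_eq_bot.2 hinj)
  let R : (ι → ℝ) × ℝ →L[ℝ] (ι → ℝ) := LinearMap.toContinuousLinearMap R'
  let G : M → (ι → ℝ) →L[ℝ] (ι → ℝ) := fun q =>
    ∑ i, ContinuousLinearMap.smulRightL ℝ (ι → ℝ) (ι → ℝ) (ContinuousLinearMap.proj i) (R (g i q))
  have hG : ∀ q a, G q a = R (∑ i, a i • g i q) := by
    intro q a
    simp [G]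
  have hGp : G p = (ContinuousLinearEquiv.refl ℝ (ι → ℝ) : (ι → ℝ) →L[ℝ] (ι → ℝ)) := by
    ext1 a
    rw [hG, ← hB]
    exact congr($hR' a)
  have hGs : ∀ᶠ q in 𝓝 p, ContMDiffAt 𝓘(ℝ, E) 𝓘(ℝ, (ι → ℝ) →L[ℝ] (ι → ℝ)) ∞ G q := by
    have h1 : ∀ᶠ q in 𝓝 p, ∀ i j, CMDiffAt ∞ (fun q => D.γ q (e i q) (e j q)) q :=
      Filter.eventually_all.2 fun i => Filter.eventually_all.2 fun j =>
        D.smoothTensor_γ.smooth p _ _ (he i) (he j)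
    have h2 : ∀ᶠ q in 𝓝 p, ∀ i, CMDiffAt ∞ (fun q => D.ell q (e i q)) q :=
      Filter.eventually_all.2 fun i => D.smoothTensor_ell.smooth p _ (he i)
    filter_upwards [h1, h2] with q h1 h2
    refine ContMDiffAt.sum fun i _ => ?_
    have h3 : ContMDiffAt 𝓘(ℝ, E) 𝓘(ℝ, (ι → ℝ) × ℝ) ∞ (g i) q :=
      ContMDiffAt.prodMk_space (contMDiffAt_pi_space.2 fun j => h1 i j) (h2 i)
    exact (ContinuousLinearMap.contMDiff
      ((ContinuousLinearMap.smulRightL ℝ (ι → ℝ) (ι → ℝ) (ContinuousLinearMap.proj i)).comp R)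
      ).contMDiffAt.comp q h3
  have hGi : ∀ᶠ q in 𝓝 p, (G q).IsInvertible := by
    have h1 := ContinuousLinearEquiv.nhds (ContinuousLinearEquiv.refl ℝ (ι → ℝ))
    rw [← hGp] at h1
    filter_upwards [hGs.self_of_nhds.continuousAt h1] with q hq using hq
  have hw : ∀ᶠ q in 𝓝 p, ContMDiffAt 𝓘(ℝ, E) 𝓘(ℝ, (ι → ℝ) × ℝ) ∞
      (fun q => ((fun j => D.γ q (V q) (e j q), D.ell q (V q)) : (ι → ℝ) × ℝ)) q := by
    filter_upwards [Filter.eventually_all.2 fun j => hγ (e j) (he j), hℓ] with q h1 h2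
    exact ContMDiffAt.prodMk_space (contMDiffAt_pi_space.2 fun j => h1 j) h2
  have hV : ∀ᶠ q in 𝓝 p, V q = ∑ i, ((G q).inverse
      (R (fun j => D.γ q (V q) (e j q), D.ell q (V q)))) i • e i q := by
    filter_upwards [hGi, hc V] with q hi hv
    have h1 : G q (fun i => c V i q) = R (fun j => D.γ q (V q) (e j q), D.ell q (V q)) := by
      rw [hG, hpair, ← hv]
    rw [← h1, hi.inverse_apply_self]
    exact hv
  refine SmoothFieldNear.congr ?_ hV
  filter_upwards [hGs, hGi, hw, Filter.eventually_all.2 he] with q h1 h2 h3 h4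
  have h5 : ContMDiffAt 𝓘(ℝ, E) 𝓘(ℝ, (ι → ℝ) →L[ℝ] (ι → ℝ)) ∞ (fun q => (G q).inverse) q :=
    (h2.contDiffAt_map_inverse.contMDiffAt).comp q h1
  have h6 := h5.clm_apply (R.contMDiff.contMDiffAt.comp q h3)
  rw [contMDiffAt_pi_space] at h6
  exact ContMDiffAt.sum_section fun i _ => (h6 i).smul_section (h4 i)

end MetricHypersurfaceData
end NullHyp

namespace NullHyp

section
variable {E : Type*} [NormedAddCommGroup E] [NormedSpace ℝ E] [FiniteDimensional ℝ E]
  {M : Type*} [TopologicalSpace M] [ChartedSpace E M] [IsManifold 𝓘(ℝ, E) ∞ M]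

theorem SmoothTensor2.const_mul {T : Tensor2 E M} (hT : SmoothTensor2 T) (c : ℝ) :
    SmoothTensor2 (fun q x y => c * T q x y) where
  linear_left p w := ⟨fun u v => by rw [(hT.linear_left p w).map_add, mul_add],
    fun a u => by rw [(hT.linear_left p w).map_smul, smul_eq_mul, smul_eq_mul]; ring⟩
  linear_right p w := ⟨fun u v => by rw [(hT.linear_right p w).map_add, mul_add],
    fun a u => by rw [(hT.linear_right p w).map_smul, smul_eq_mul, smul_eq_mul]; ring⟩
  smooth p X Y hX hY := (SmoothNear.const c).mul (hT.smooth p X Y hX hY)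

theorem lieBr_self (X : VField E M) (p : M) : lieBr X X p = 0 := by
  simp [lieBr]

end

namespace MetricHypersurfaceData

variable {E : Type*} [NormedAddCommGroup E] [NormedSpace ℝ E] [FiniteDimensional ℝ E]
  {M : Type*} [TopologicalSpace M] [ChartedSpace E M] [IsManifold 𝓘(ℝ, E) ∞ M]
  {D : MetricHypersurfaceData E M} {p : M} {X Y Z V : VField E M}

/-! ### The tensors `U` and `s` of null data -/

theorem γ_n (h0 : ∀ p, D.n2 p = 0) (w : TangentSpace 𝓘(ℝ, E) p) : D.γ p (D.n p) w = 0 := by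
  simpa [h0] using D.prod1 p w

theorem ell_n (h0 : ∀ p, D.n2 p = 0) (p : M) : D.ell p (D.n p) = 1 := by
  simpa [h0] using D.prod2 p

theorem U_eq_lieDer (h0 : ∀ p, D.n2 p = 0) :
    D.U = fun p u w => (1 / 2) * lieDer D.n (fun q v w => D.γ q v w) p u w := by
  have : D.n2 = fun _ => 0 := funext h0
  ext p u w
  simp [U, this, dir_const]

theorem smoothTensor_U (h0 : ∀ p, D.n2 p = 0) : SmoothTensor2 D.U := by
  rw [U_eq_lieDer h0]
  exact (D.smoothTensor_γ.lieDer D.smoothFieldNear_n).const_mul _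

/-- The definition `£_n γ = 2 U`, evaluated on vector fields. -/
theorem dir_γ_n (h0 : ∀ p, D.n2 p = 0) (hX : MDiffAt (T% X) p) (hY : MDiffAt (T% Y) p) :
    dir (fun q => D.γ q (X q) (Y q)) p (D.n p)
      = 2 * D.U p (X p) (Y p) + D.γ p (lieBr D.n X p) (Y p) + D.γ p (X p) (lieBr D.n Y p) := by
  have := lieDer_apply (Z := D.n) D.smoothTensor_γ hX hY
  simp only [U_eq_lieDer h0, this]
  ring

theorem U_n (h0 : ∀ p, D.n2 p = 0) (w : TangentSpace 𝓘(ℝ, E) p) : D.U p (D.n p) w = 0 := by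
  have h := dir_γ_n h0 (D.smoothFieldNear_n p).mdiff (mdiff_ext w)
  simp only [γ_n h0, dir_const, lieBr_self, map_zero, ContinuousLinearMap.zero_apply, ext_self] at h
  linarith

/-- For null data `£_n ℓ = 2 s`, by Cartan's formula and `ℓ(n) = 1`; here it is evaluated on a
vector field. -/
theorem dir_ell_n (h0 : ∀ p, D.n2 p = 0) (hX : MDiffAt (T% X) p) :
    dir (fun q => D.ell q (X q)) p (D.n p)
      = 2 * D.s p (X p) + D.ell p (lieBr D.n X p) := by
  obtain ⟨B, hB⟩ := (isFieldDerivation_lieBr D.n p).exists_linear D.smoothTensor_ell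
  have h1 := hB X hX
  have h2 := hB _ (mdiff_ext (X p))
  rw [ext_self] at h2
  have h3 := extDer_apply_left D.smoothTensor_ell (D.smoothFieldNear_n p).mdiff (X p)
  simp only [ell_n h0, dir_const] at h3
  rw [s, h3]
  linarith

theorem s_n (h0 : ∀ p, D.n2 p = 0) (p : M) : D.s p (D.n p) = 0 := by
  have h := dir_ell_n h0 (D.smoothFieldNear_n p).mdiff
  simp only [ell_n h0, dir_const, lieBr_self, map_zero] at h
  linarith

theorem smoothTensor_s (h0 : ∀ p, D.n2 p = 0) : SmoothTensor1 D.s := by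
  have key : ∀ {p : M} {X : VField E M}, MDiffAt (T% X) p → D.s p (X p)
      = (1 / 2) * (dir (fun q => D.ell q (X q)) p (D.n p) - D.ell p (lieBr D.n X p)) := by
    intro p X hX
    rw [dir_ell_n h0 hX]
    ring
  refine ⟨fun p => ?_, fun p X hX => ?_⟩
  · obtain ⟨B, hB⟩ := (isFieldDerivation_lieBr D.n p).exists_linear D.smoothTensor_ell
    have h : ∀ u, D.s p u = (1 / 2) * B u := by
      intro u
      have h1 := key (mdiff_ext u)
      rw [← hB _ (mdiff_ext u), ext_self] at h1
      exact h1
    exact ⟨fun u v => by rw [h, h, h, map_add, mul_add],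
      fun a u => by rw [h, h, map_smul, smul_eq_mul, smul_eq_mul]; ring⟩
  · refine ((SmoothNear.const (1 / 2)).mul (((D.smoothTensor_ell.smooth p X hX).dir
      (D.smoothFieldNear_n p)).sub (D.smoothTensor_ell.smooth p _
      ((D.smoothFieldNear_n p).lieBr hX)))).congr ?_
    filter_upwards [hX.eventually] with q hq using key hq.mdiff

/-! ### The metric hypersurface connection on vector fields -/

theorem isMetricHypersurfaceConnection : D.IsMetricHypersurfaceConnection D.connection :=
  D.exists_connection.choose_spec

theorem connection_sub (hX : MDiffAt (T% X) p) (hY : MDiffAt (T% Y) p) :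
    D.connection Y p (X p) - D.connection X p (Y p) = lieBr X Y p :=
  D.connection.torsion_eq_zero_iff.1 D.isMetricHypersurfaceConnection.torsion_eq_zero hX hY

/-- The equation for `∇γ`, evaluated on vector fields. -/
theorem dir_γ (u : TangentSpace 𝓘(ℝ, E) p) (hX : MDiffAt (T% X) p) (hY : MDiffAt (T% Y) p) :
    dir (fun q => D.γ q (X q) (Y q)) p u
      = D.γ p (D.connection X p u) (Y p) + D.γ p (X p) (D.connection Y p u)
        - D.U p u (X p) * D.ell p (Y p) - D.U p u (Y p) * D.ell p (X p) := by
  have h1 := covDer2_apply (D := D.connection) D.smoothTensor_γ u hX hY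
  rw [D.isMetricHypersurfaceConnection.covDer_γ] at h1
  linarith

/-- The equation for the symmetric part of `∇ℓ`, evaluated on vector fields. -/
theorem dir_ell (hX : MDiffAt (T% X) p) (hY : MDiffAt (T% Y) p) :
    dir (fun q => D.ell q (Y q)) p (X p) + dir (fun q => D.ell q (X q)) p (Y p)
      = D.ell p (D.connection Y p (X p)) + D.ell p (D.connection X p (Y p))
        - 2 * D.ell2 p * D.U p (X p) (Y p) := by
  have h1 := covDer1_apply (D := D.connection) D.smoothTensor_ell (X p) hY
  have h2 := covDer1_apply (D := D.connection) D.smoothTensor_ell (Y p) hX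
  have h3 := D.isMetricHypersurfaceConnection.covDer_ell p (X p) (Y p)
  linarith

/-- The Koszul formula for the metric hypersurface connection. -/
theorem γ_connection (hX : MDiffAt (T% X) p) (hY : MDiffAt (T% Y) p) (hZ : MDiffAt (T% Z) p) :
    D.γ p (D.connection Y p (X p)) (Z p) = (1 / 2) * (dir (fun q => D.γ q (Y q) (Z q)) p (X p)
      + dir (fun q => D.γ q (X q) (Z q)) p (Y p) - dir (fun q => D.γ q (X q) (Y q)) p (Z p)
      + D.γ p (lieBr X Y p) (Z p) - D.γ p (lieBr X Z p) (Y p) - D.γ p (lieBr Y Z p) (X p))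
      + D.U p (X p) (Y p) * D.ell p (Z p) := by
  rw [dir_γ _ hY hZ, dir_γ _ hX hZ, dir_γ _ hX hY, ← connection_sub hX hY,
    ← connection_sub hX hZ, ← connection_sub hY hZ, D.U_symm p (Y p) (X p),
    D.U_symm p (Z p) (X p), D.U_symm p (Z p) (Y p), D.γ_symm p (Y p), D.γ_symm p (X p),
    D.γ_symm p (X p)]
  simp only [map_sub, ContinuousLinearMap.sub_apply]
  ring

/-- The analogue for `ℓ` of the Koszul formula. -/
theorem ell_connection (hX : MDiffAt (T% X) p) (hY : MDiffAt (T% Y) p) :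
    D.ell p (D.connection Y p (X p)) = (1 / 2) * (dir (fun q => D.ell q (Y q)) p (X p)
      + dir (fun q => D.ell q (X q)) p (Y p) + D.ell p (lieBr X Y p))
      + D.ell2 p * D.U p (X p) (Y p) := by
  rw [dir_ell hX hY, ← connection_sub hX hY]
  simp only [map_sub]
  ring

theorem smoothFieldNear_connection (h0 : ∀ p, D.n2 p = 0) (hX : SmoothFieldNear X p)
    (hY : SmoothFieldNear Y p) : SmoothFieldNear (fun q => D.connection Y q (X q)) p := by
  have hγ := D.smoothTensor_γ
  have hℓ := D.smoothTensor_ell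
  have hU := smoothTensor_U h0
  refine D.smoothFieldNear_of_pairing (fun Z hZ => ?_) ?_
  · refine (((SmoothNear.const (1 / 2)).mul
      (((((((hγ.smooth p Y Z hY hZ).dir hX).add
      ((hγ.smooth p X Z hX hZ).dir hY)).sub
      ((hγ.smooth p X Y hX hY).dir hZ)).add
      (hγ.smooth p _ Z (hX.lieBr hY) hZ)).sub
      (hγ.smooth p _ Y (hX.lieBr hZ) hY)).sub
      (hγ.smooth p _ X (hY.lieBr hZ) hX))).add
      ((hU.smooth p X Y hX hY).mul (hℓ.smooth p Z hZ))).congr ?_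
    filter_upwards [hX.eventually, hY.eventually, hZ.eventually] with q h1 h2 h3
    exact γ_connection h1.mdiff h2.mdiff h3.mdiff
  · refine (((SmoothNear.const (1 / 2)).mul
      ((((hℓ.smooth p Y hY).dir hX).add ((hℓ.smooth p X hX).dir hY)).add
      (hℓ.smooth p _ (hX.lieBr hY)))).add
      ((D.smoothNear_ell2 p).mul (hU.smooth p X Y hX hY))).congr ?_
    filter_upwards [hX.eventually, hY.eventually] with q h1 h2
    exact ell_connection h1.mdiff h2.mdiff

end MetricHypersurfaceData
end NullHyp

namespace NullHyp
namespace MetricHypersurfaceData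

variable {E : Type*} [NormedAddCommGroup E] [NormedSpace ℝ E] [FiniteDimensional ℝ E]
  {M : Type*} [TopologicalSpace M] [ChartedSpace E M] [IsManifold 𝓘(ℝ, E) ∞ M]
  {D : MetricHypersurfaceData E M} {p : M}

/-! ### The Lie derivative of the connection along `n` -/

theorem Sigma_eq (u w : TangentSpace 𝓘(ℝ, E) p) :
    D.Sigma p u w = lieBr D.n (fun q => D.connection (ext w) q (ext u q)) p
      - D.connection (lieBr D.n (ext w)) p u - D.connection (ext w) p (lieBr D.n (ext u) p) := rfl

/-- As the connection is torsion-free, the symmetry of `Σ` is the Jacobi identity. -/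
theorem Sigma_symm (h0 : ∀ p, D.n2 p = 0) (u w : TangentSpace 𝓘(ℝ, E) p) :
    D.Sigma p u w = D.Sigma p w u := by
  have hn := D.smoothFieldNear_n p
  have hu := smoothFieldNear_ext u
  have hw := smoothFieldNear_ext w
  have h1 : lieBr D.n (fun q => D.connection (ext w) q (ext u q)) p
      = lieBr D.n (fun q => D.connection (ext u) q (ext w q)) p
        + lieBr D.n (lieBr (ext u) (ext w)) p := by
    rw [← lieBr_add_right (smoothFieldNear_connection h0 hw hu).mdiff (hu.lieBr hw).mdiff]
    refine Filter.EventuallyEq.mlieBracket_vectorField_eq Filter.EventuallyEq.rfl ?_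
    filter_upwards [hu.eventually, hw.eventually] with q h2 h3
    rw [Pi.add_apply, ← connection_sub h2.mdiff h3.mdiff]
    abel
  have h2 := connection_sub (D := D) (hn.lieBr hu).mdiff hw.mdiff
  have h3 := connection_sub (D := D) hu.mdiff (hn.lieBr hw).mdiff
  rw [ext_self] at h2 h3
  have h4 := lieBr_leibniz hn hu hw
  rw [Sigma_eq, Sigma_eq, h1, h4, ← h2, ← h3]
  abel

/-- The Lie derivative along `n` of the equation for the covariant derivative of `γ`: the
derivatives of `γ(z, w)` along `n` and `u` are commuted by means of `[n, u]`. -/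
theorem γ_Sigma_add (h0 : ∀ p, D.n2 p = 0) (u z w : TangentSpace 𝓘(ℝ, E) p) :
    D.γ p (D.Sigma p u z) w + D.γ p z (D.Sigma p u w)
      = 2 * covDer2 D.connection D.U p u z w
        + lieDer D.n D.U p u z * D.ell p w + 2 * D.U p u z * D.s p w
        + lieDer D.n D.U p u w * D.ell p z + 2 * D.U p u w * D.s p z := by
  have hγ := D.smoothTensor_γ
  have hℓ := D.smoothTensor_ell
  have hU := smoothTensor_U h0
  have hn := D.smoothFieldNear_n p
  have hu := smoothFieldNear_ext u
  have hz := smoothFieldNear_ext z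
  have hw := smoothFieldNear_ext w
  have huz := smoothFieldNear_connection h0 hu hz
  have huw := smoothFieldNear_connection h0 hu hw
  -- the derivative along `n` of `u(γ(z, w))`, from the equation for `∇γ`
  have a1 : dir (fun q => dir (fun r => D.γ r (ext z r) (ext w r)) q (ext u q)) p (D.n p)
      = dir (fun q => D.γ q (D.connection (ext z) q (ext u q)) (ext w q)) p (D.n p)
        + dir (fun q => D.γ q (ext z q) (D.connection (ext w) q (ext u q))) p (D.n p)
        - dir (fun q => D.U q (ext u q) (ext z q) * D.ell q (ext w q)) p (D.n p)
        - dir (fun q => D.U q (ext u q) (ext w q) * D.ell q (ext z q)) p (D.n p) := by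
    have d1 := hγ.mdiff huz.mdiff hw.mdiff
    have d2 := hγ.mdiff hz.mdiff huw.mdiff
    have d3 := (hU.mdiff hu.mdiff hz.mdiff).mul (hℓ.mdiff hw.mdiff)
    have d4 := (hU.mdiff hu.mdiff hw.mdiff).mul (hℓ.mdiff hz.mdiff)
    rw [← dir_add _ d1 d2]
    erw [← dir_sub _ (d1.add d2) d3]
    erw [← dir_sub _ ((d1.add d2).sub d3) d4]
    refine dir_congr ?_ _
    filter_upwards [hz.eventually, hw.eventually] with q h1 h2
    exact dir_γ _ h1.mdiff h2.mdiff
  -- the derivative along `u` of `n(γ(z, w))`, from `£_n γ = 2 U`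
  have a2 : dir (fun q => dir (fun r => D.γ r (ext z r) (ext w r)) q (D.n q)) p (ext u p)
      = 2 * dir (fun q => D.U q (ext z q) (ext w q)) p (ext u p)
        + dir (fun q => D.γ q (lieBr D.n (ext z) q) (ext w q)) p (ext u p)
        + dir (fun q => D.γ q (ext z q) (lieBr D.n (ext w) q)) p (ext u p) := by
    have d1 := hU.mdiff hz.mdiff hw.mdiff
    have d2 := hγ.mdiff (hn.lieBr hz).mdiff hw.mdiff
    have d3 := hγ.mdiff hz.mdiff (hn.lieBr hw).mdiff
    have d1' : MDiffAt (fun q => 2 * D.U q (ext z q) (ext w q)) p :=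
      (mdifferentiableAt_const (c := (2 : ℝ))).mul d1
    rw [← dir_const_mul _ _ d1, ← dir_add _ d1' d2]
    erw [← dir_add _ (d1'.add d2) d3]
    refine dir_congr ?_ _
    filter_upwards [hz.eventually, hw.eventually] with q h1 h2
    exact dir_γ_n h0 h1.mdiff h2.mdiff
  have a3 := dir_lieBr (hγ.smooth p _ _ hz hw) hn hu
  rw [a1, a2, dir_γ _ hz.mdiff hw.mdiff, dir_γ _ (hn.lieBr hz).mdiff hw.mdiff,
    dir_γ _ hz.mdiff (hn.lieBr hw).mdiff, dir_γ_n h0 huz.mdiff hw.mdiff,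
    dir_γ_n h0 hz.mdiff huw.mdiff,
    dir_mul _ (hU.mdiff hu.mdiff hz.mdiff) (hℓ.mdiff hw.mdiff),
    dir_mul _ (hU.mdiff hu.mdiff hw.mdiff) (hℓ.mdiff hz.mdiff),
    dir_ell_n h0 hw.mdiff, dir_ell_n h0 hz.mdiff] at a3
  have b1 := lieDer_apply (Z := D.n) hU hu.mdiff hz.mdiff
  have b2 := lieDer_apply (Z := D.n) hU hu.mdiff hw.mdiff
  have b3 := covDer2_apply (D := D.connection) hU (ext u p) hz.mdiff hw.mdiff
  simp only [ext_self] at a3 b1 b2 b3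
  rw [Sigma_eq, Sigma_eq]
  simp only [map_sub, ContinuousLinearMap.sub_apply]
  linear_combination -a3 - D.ell p w * b1 - D.ell p z * b2 - 2 * b3

/-- The Lie derivative along `n` of the equation for the symmetrized covariant derivative of `ℓ`. -/
theorem ell_Sigma (h0 : ∀ p, D.n2 p = 0) (u w : TangentSpace 𝓘(ℝ, E) p) :
    D.ell p (D.Sigma p u w)
      = covDer1 D.connection D.s p u w + covDer1 D.connection D.s p w u
        + dir D.ell2 p (D.n p) * D.U p u w + D.ell2 p * lieDer D.n D.U p u w := by
  have hℓ := D.smoothTensor_ell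
  have hU := smoothTensor_U h0
  have hs := smoothTensor_s h0
  have hn := D.smoothFieldNear_n p
  have hu := smoothFieldNear_ext u
  have hw := smoothFieldNear_ext w
  have huw := smoothFieldNear_connection h0 hu hw
  have hwu := smoothFieldNear_connection h0 hw hu
  have e1 := (hℓ.smooth p _ hw).dir hu
  have e2 := (hℓ.smooth p _ hu).dir hw
  have a1 : dir (fun q => dir (fun r => D.ell r (ext w r)) q (ext u q)) p (D.n p)
        + dir (fun q => dir (fun r => D.ell r (ext u r)) q (ext w q)) p (D.n p)
      = dir (fun q => D.ell q (D.connection (ext w) q (ext u q))) p (D.n p)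
        + dir (fun q => D.ell q (D.connection (ext u) q (ext w q))) p (D.n p)
        - dir (fun q => 2 * D.ell2 q * D.U q (ext u q) (ext w q)) p (D.n p) := by
    have d1 := hℓ.mdiff huw.mdiff
    have d2 := hℓ.mdiff hwu.mdiff
    have d3 : MDiffAt (fun q => 2 * D.ell2 q * D.U q (ext u q) (ext w q)) p :=
      ((mdifferentiableAt_const (c := (2 : ℝ))).mul (D.smoothNear_ell2 p).mdiff).mul
        (hU.mdiff hu.mdiff hw.mdiff)
    rw [← dir_add _ e1.mdiff e2.mdiff, ← dir_add _ d1 d2]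
    erw [← dir_sub _ (d1.add d2) d3]
    refine dir_congr ?_ _
    filter_upwards [hu.eventually, hw.eventually] with q h1 h2
    exact dir_ell h1.mdiff h2.mdiff
  have a2 : ∀ {x z : TangentSpace 𝓘(ℝ, E) p},
      dir (fun q => dir (fun r => D.ell r (ext z r)) q (D.n q)) p (ext x p)
      = 2 * dir (fun q => D.s q (ext z q)) p (ext x p)
        + dir (fun q => D.ell q (lieBr D.n (ext z) q)) p (ext x p) := by
    intro x z
    have hz := smoothFieldNear_ext z
    have d1 := hs.mdiff hz.mdiff
    have d2 := hℓ.mdiff (hn.lieBr hz).mdiff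
    have d1' : MDiffAt (fun q => 2 * D.s q (ext z q)) p :=
      (mdifferentiableAt_const (c := (2 : ℝ))).mul d1
    rw [← dir_const_mul _ _ d1, ← dir_add _ d1' d2]
    refine dir_congr ?_ _
    filter_upwards [hz.eventually] with q h1
    exact dir_ell_n h0 h1.mdiff
  have a3 := dir_lieBr (hℓ.smooth p _ hw) hn hu
  have a4 := dir_lieBr (hℓ.smooth p _ hu) hn hw
  have d5 : MDiffAt (fun q => 2 * D.ell2 q) p :=
    (mdifferentiableAt_const (c := (2 : ℝ))).mul (D.smoothNear_ell2 p).mdiff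
  rw [a2] at a3 a4
  rw [dir_ell_n h0 huw.mdiff, dir_ell_n h0 hwu.mdiff,
    dir_mul _ d5 (hU.mdiff hu.mdiff hw.mdiff),
    dir_const_mul _ _ (D.smoothNear_ell2 p).mdiff] at a1
  have b1 := lieDer_apply (Z := D.n) hU hu.mdiff hw.mdiff
  have b2 := covDer1_apply (D := D.connection) hs (ext u p) hw.mdiff
  have b3 := covDer1_apply (D := D.connection) hs (ext w p) hu.mdiff
  have b4 := dir_ell (D := D) (hn.lieBr hu).mdiff hw.mdiff
  have b5 := dir_ell (D := D) hu.mdiff (hn.lieBr hw).mdiff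
  have b6 := congrArg (D.ell p) (Sigma_symm h0 u w)
  simp only [ext_self] at a1 a3 a4 b1 b2 b3 b4 b5
  rw [Sigma_eq, Sigma_eq] at b6
  rw [Sigma_eq]
  simp only [map_sub] at b6 ⊢
  linear_combination (1 / 2) * (b6 - a1 - a3 - a4 + b4 + b5) - D.ell2 p * b1 - b2 - b3

/-- The value of `γ` on `Σ`, obtained from `γ_Sigma_add` by the permutation of arguments that
yields the Koszul formula. -/
theorem γ_Sigma (h0 : ∀ p, D.n2 p = 0) (u z w : TangentSpace 𝓘(ℝ, E) p) :
    D.γ p (D.Sigma p u z) w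
      = covDer2 D.connection D.U p u z w + covDer2 D.connection D.U p z u w
        - covDer2 D.connection D.U p w u z
        + lieDer D.n D.U p u z * D.ell p w + 2 * D.U p u z * D.s p w := by
  have hc : ∀ x y z : TangentSpace 𝓘(ℝ, E) p,
      covDer2 D.connection D.U p x y z = covDer2 D.connection D.U p x z y := by
    intro x y z
    simp only [covDer2, D.U_symm _ (ext y _), D.U_symm p y, D.U_symm p z]
    ring
  have hL : ∀ x y : TangentSpace 𝓘(ℝ, E) p, lieDer D.n D.U p x y = lieDer D.n D.U p y x := by
    intro x y
    simp only [lieDer, D.U_symm _ (ext x _), D.U_symm p x, D.U_symm p y]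
    ring
  have h1 := γ_Sigma_add h0 u z w
  have h2 := γ_Sigma_add h0 z u w
  have h3 := γ_Sigma_add h0 w u z
  rw [Sigma_symm h0 z u, D.γ_symm p u] at h2
  rw [Sigma_symm h0 w u, Sigma_symm h0 w z, D.γ_symm p u] at h3
  rw [D.γ_symm p z] at h1
  rw [hL z u, D.U_symm p z u] at h2
  rw [hL w u, hL w z, D.U_symm p w u, D.U_symm p w z] at h3
  linear_combination (1 / 2) * (h1 + h2 - h3)

end MetricHypersurfaceData
end NullHyp

namespace NullHyp

section Separation
variable {E : Type*} [NormedAddCommGroup E] [NormedSpace ℝ E] [FiniteDimensional ℝ E]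
  {M : Type*} [TopologicalSpace M] [ChartedSpace E M] [IsManifold 𝓘(ℝ, E) ∞ M] {p : M}

/-- Tangent vectors are separated by their action on smooth functions. -/
theorem eq_of_dir_eq {v w : TangentSpace 𝓘(ℝ, E) p}
    (h : ∀ f : M → ℝ, SmoothNear E f p → dir f p v = dir f p w) : v = w := by
  have hp := mem_extChartAt_source (I := 𝓘(ℝ, E)) p
  have h1 : ∀ l : E →L[ℝ] ℝ, l (mfderiv 𝓘(ℝ, E) 𝓘(ℝ, E) (extChartAt 𝓘(ℝ, E) p) p v)
      = l (mfderiv 𝓘(ℝ, E) 𝓘(ℝ, E) (extChartAt 𝓘(ℝ, E) p) p w) := by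
    intro l
    have hs : SmoothNear E (fun q => l (extChartAt 𝓘(ℝ, E) p q)) p := by
      filter_upwards [(isOpen_extChartAt_source (I := 𝓘(ℝ, E)) p).mem_nhds hp] with q hq
      rw [extChartAt_source] at hq
      exact l.contMDiff.contMDiffAt.comp q (contMDiffAt_extChartAt' hq)
    have h2 := h _ hs
    rw [dir_comp_extChartAt hp l.differentiableAt, dir_comp_extChartAt hp l.differentiableAt,
      l.fderiv] at h2
    exact h2
  have h2 : mfderiv 𝓘(ℝ, E) 𝓘(ℝ, E) (extChartAt 𝓘(ℝ, E) p) p v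
      = mfderiv 𝓘(ℝ, E) 𝓘(ℝ, E) (extChartAt 𝓘(ℝ, E) p) p w :=
    (SeparatingDual.eq_iff_forall_dual_eq (R := ℝ) (V := E)).2 h1
  obtain ⟨e, he⟩ := isInvertible_mfderiv_extChartAt (I := 𝓘(ℝ, E)) hp
  rw [← he] at h2
  exact e.injective h2

end Separation

namespace TransverseSubmanifold

variable {E : Type*} [NormedAddCommGroup E] [NormedSpace ℝ E] [FiniteDimensional ℝ E]
  {M : Type*} [TopologicalSpace M] [ChartedSpace E M] [IsManifold 𝓘(ℝ, E) ∞ M]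
  {E' : Type*} [NormedAddCommGroup E'] [NormedSpace ℝ E'] [FiniteDimensional ℝ E']
  {S : Type*} [TopologicalSpace S] [ChartedSpace E' S] [IsManifold 𝓘(ℝ, E') ∞ S]
  {D : NullHypersurfaceData E M} (Ψ : TransverseSubmanifold E' S D) {p : S}

/-! ### Vector fields along the submanifold -/

/-- An immersion has a smooth local left inverse. -/
theorem exists_leftInverse (p : S) : ∃ g : M → S, (∀ᶠ q in 𝓝 p, g (Ψ.ψ q) = q) ∧
    ∀ᶠ y in 𝓝 (Ψ.ψ p), ContMDiffAt 𝓘(ℝ, E) 𝓘(ℝ, E') ∞ g y := by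
  have hI := Ψ.isSmoothEmbedding.isImmersion.isImmersionAt p
  have hval : ∀ x ∈ hI.domChart.source,
      (hI.equiv.symm (hI.codChart (Ψ.ψ x))).1 = hI.domChart x := by
    intro x hx
    have hm : hI.domChart x ∈ (hI.domChart.extend 𝓘(ℝ, E')).target := by
      simpa using hI.domChart.map_source hx
    have := hI.writtenInCharts hm
    simp [hI.domChart.left_inv hx] at this
    rw [this]
    simp
  have d1 : ∀ y ∈ hI.codChart.source, ContMDiffAt 𝓘(ℝ, E) 𝓘(ℝ, E')  ∞
      (fun y => (hI.equiv.symm (hI.codChart y)).1) y := by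
    intro y hy
    exact ((ContinuousLinearMap.fst ℝ E' hI.complement).comp
      (hI.equiv.symm : E →L[ℝ] E' × hI.complement)).contMDiff.contMDiffAt.comp y
      (contMDiffAt_of_mem_maximalAtlas hI.codChart_mem_maximalAtlas hy)
  refine ⟨fun y => hI.domChart.symm (hI.equiv.symm (hI.codChart y)).1, ?_, ?_⟩
  · filter_upwards [hI.domChart.open_source.mem_nhds hI.mem_domChart_source] with x hx
    rw [hval x hx, hI.domChart.left_inv hx]
  · have h1 : ∀ᶠ y in 𝓝 (Ψ.ψ p), (hI.equiv.symm (hI.codChart y)).1 ∈ hI.domChart.target := by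
      refine (d1 _ hI.mem_codChart_source).continuousAt.eventually_mem ?_
      rw [hval p hI.mem_domChart_source]
      exact hI.domChart.open_target.mem_nhds (hI.domChart.map_source hI.mem_domChart_source)
    filter_upwards [h1, hI.codChart.open_source.mem_nhds hI.mem_codChart_source] with y hy hy'
    exact (contMDiffAt_symm_of_mem_maximalAtlas hI.domChart_mem_maximalAtlas hy).comp y (d1 y hy')

/-- `X'` is a smooth extension to the ambient manifold, near `ψ(p)`, of the vector field `X`
on the submanifold, which is itself smooth near `p`. -/
structure IsExtension (X : VField E' S) (p : S) (X' : VField E M) : Prop where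
  smooth : SmoothFieldNear X p
  smooth' : SmoothFieldNear X' (Ψ.ψ p)
  related : ∀ᶠ q in 𝓝 p, X' (Ψ.ψ q) = Ψ.dψ q (X q)

/-- Extension by means of a local left inverse `g` of `ψ`: the value at `y` is the image of the
field at `g(y)`, moved from `ψ(g(y))` to `y` in a trivialization of the tangent bundle. -/
theorem exists_extension {W : VField E' S} (hW : SmoothFieldNear W p) :
    ∃ W' : VField E M, Ψ.IsExtension W p W' := by
  obtain ⟨g, hg, hgs⟩ := Ψ.exists_leftInverse p
  let t := trivializationAt E (TangentSpace 𝓘(ℝ, E) : M → Type _) (Ψ.ψ p)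
  have hp : Ψ.ψ p ∈ t.baseSet := FiberBundle.mem_baseSet_trivializationAt' _
  have hgp : g (Ψ.ψ p) = p := hg.self_of_nhds
  let F : M → TangentBundle 𝓘(ℝ, E) M := fun y =>
    tangentMap 𝓘(ℝ, E') 𝓘(ℝ, E) Ψ.ψ ((T% W) (g y))
  have hψ : ContMDiff 𝓘(ℝ, E').tangent 𝓘(ℝ, E).tangent ∞ (tangentMap 𝓘(ℝ, E') 𝓘(ℝ, E) Ψ.ψ) :=
    Ψ.contMDiff_ψ.contMDiff_tangentMap (by simp)
  refine ⟨fun y => t.symm y (t (F y)).2, hW, ?_, ?_⟩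
  · have hgc : ContinuousAt g (Ψ.ψ p) := hgs.self_of_nhds.continuousAt
    have h1 : ∀ᶠ y in 𝓝 (Ψ.ψ p), CMDiffAt ∞ (T% W) (g y) := by
      have : Filter.Tendsto g (𝓝 (Ψ.ψ p)) (𝓝 p) := by simpa [ContinuousAt, hgp] using hgc
      exact this.eventually hW
    have h2 : ∀ᶠ y in 𝓝 (Ψ.ψ p), Ψ.ψ (g y) ∈ t.baseSet := by
      have : ContinuousAt (fun y => Ψ.ψ (g y)) (Ψ.ψ p) :=
        Ψ.contMDiff_ψ.continuous.continuousAt.comp hgc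
      exact this.eventually_mem (t.open_baseSet.mem_nhds (by rwa [hgp]))
    filter_upwards [hgs, h1, h2, t.open_baseSet.mem_nhds hp] with y hy h1 h2 h3
    have hF : ContMDiffAt 𝓘(ℝ, E) 𝓘(ℝ, E).tangent ∞ F y :=
      hψ.contMDiffAt.comp y (ContMDiffAt.comp y (g := T% W) h1 hy)
    have hF2 := ((t.contMDiffAt_iff (IB := 𝓘(ℝ, E)) (n := ∞) (f := F) (x₀ := y) (by
      rw [t.mem_source]; exact h2)).1 hF).2
    rw [t.contMDiffAt_section_iff h3]
    refine hF2.congr_of_eventuallyEq ?_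
    filter_upwards [t.open_baseSet.mem_nhds h3] with r hr
    have := congrArg Prod.snd (t.apply_mk_symm hr (t (F r)).2)
    exact this
  · have hc := Ψ.contMDiff_ψ.continuous.continuousAt (x := p)
    filter_upwards [hg, hc.eventually_mem (t.open_baseSet.mem_nhds hp)] with q h1 h2
    have hF : F (Ψ.ψ q) = ⟨Ψ.ψ q, Ψ.dψ q (W q)⟩ := by
      change tangentMap 𝓘(ℝ, E') 𝓘(ℝ, E) Ψ.ψ ((T% W) (g (Ψ.ψ q))) = _
      rw [h1]
      rfl
    rw [hF]
    exact t.symm_apply_apply_mk h2 _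

theorem dir_comp_ψ {f : M → ℝ} (hf : MDiffAt f (Ψ.ψ p)) (v : TangentSpace 𝓘(ℝ, E') p) :
    dir (fun q => f (Ψ.ψ q)) p v = dir f (Ψ.ψ p) (Ψ.dψ p v) :=
  mvfderiv_comp_apply p hf (Ψ.contMDiff_ψ.mdifferentiableAt (by simp)) v

variable {Ψ}
variable {X W : VField E' S} {X' W' : VField E M}

theorem IsExtension.eventually (h : Ψ.IsExtension X p X') : ∀ᶠ q in 𝓝 p, Ψ.IsExtension X q X' := by
  filter_upwards [h.smooth.eventually, h.related.eventually_nhds,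
    Ψ.contMDiff_ψ.continuous.continuousAt.eventually h.smooth'.eventually] with q h1 h2 h3
  exact ⟨h1, h3, h2⟩

theorem IsExtension.apply (h : Ψ.IsExtension X p X') : X' (Ψ.ψ p) = Ψ.dψ p (X p) :=
  h.related.self_of_nhds

theorem smoothNear_comp_ψ {f : M → ℝ} (hf : SmoothNear E f (Ψ.ψ p)) :
    SmoothNear E' (fun q => f (Ψ.ψ q)) p := by
  filter_upwards [Ψ.contMDiff_ψ.continuous.continuousAt.eventually hf] with q hq
  exact hq.comp q Ψ.contMDiff_ψ.contMDiffAt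

/-- The Lie bracket of extensions is an extension of the Lie bracket. -/
theorem IsExtension.lieBr_apply (hX : Ψ.IsExtension X p X') (hW : Ψ.IsExtension W p W') :
    lieBr X' W' (Ψ.ψ p) = Ψ.dψ p (lieBr X W p) := by
  refine eq_of_dir_eq fun f hf => ?_
  have key : ∀ {X : VField E' S} {X' : VField E M}, Ψ.IsExtension X p X' →
      ∀ᶠ q in 𝓝 p, dir (fun r => f (Ψ.ψ r)) q (X q) = dir f (Ψ.ψ q) (X' (Ψ.ψ q)) := by
    intro X X' h
    filter_upwards [h.eventually,
      Ψ.contMDiff_ψ.continuous.continuousAt.eventually hf.eventually] with q h1 h2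
    rw [Ψ.dir_comp_ψ h2.mdiff, h1.apply]
  rw [← Ψ.dir_comp_ψ hf.mdiff, dir_lieBr hf hX.smooth' hW.smooth',
    dir_lieBr (smoothNear_comp_ψ hf) hX.smooth hW.smooth, dir_congr (key hX), dir_congr (key hW),
    hX.apply, hW.apply, Ψ.dir_comp_ψ (f := fun y => dir f y (W' y)) (hf.dir hW.smooth').mdiff,
    Ψ.dir_comp_ψ (f := fun y => dir f y (X' y)) (hf.dir hX.smooth').mdiff]

end TransverseSubmanifold
end NullHyp

namespace NullHyp
namespace TransverseSubmanifold

open MetricHypersurfaceData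

variable {E : Type*} [NormedAddCommGroup E] [NormedSpace ℝ E] [FiniteDimensional ℝ E]
  {M : Type*} [TopologicalSpace M] [ChartedSpace E M] [IsManifold 𝓘(ℝ, E) ∞ M]
  {E' : Type*} [NormedAddCommGroup E'] [NormedSpace ℝ E'] [FiniteDimensional ℝ E']
  {S : Type*} [TopologicalSpace S] [ChartedSpace E' S] [IsManifold 𝓘(ℝ, E') ∞ S]
  {D : NullHypersurfaceData E M} (Ψ : TransverseSubmanifold E' S D) {p : S}

/-! ### The Gauss formula -/

theorem isLeviCivita : Ψ.IsLeviCivita Ψ.leviCivita := Ψ.exists_leviCivita.choose_spec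

theorem leviCivita_sub {X Y : VField E' S} (hX : MDiffAt (T% X) p) (hY : MDiffAt (T% Y) p) :
    Ψ.leviCivita Y p (X p) - Ψ.leviCivita X p (Y p) = lieBr X Y p :=
  Ψ.leviCivita.torsion_eq_zero_iff.1 Ψ.isLeviCivita.torsion_eq_zero hX hY

theorem γ_dψ_ellSharp (p : S) (v : TangentSpace 𝓘(ℝ, E') p) :
    D.γ (Ψ.ψ p) (Ψ.dψ p (Ψ.ellSharp p)) (Ψ.dψ p v) = D.ell (Ψ.ψ p) (Ψ.dψ p v) :=
  congr($(Ψ.h_ellSharp p) v)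

/-- The metric hypersurface connection on fields tangent to the submanifold, paired by means of `γ`
with a tangent vector. The summand with `U` comes from the equation for `∇γ`. -/
theorem γ_connection_sub (u v w : TangentSpace 𝓘(ℝ, E') p) {V : VField E M}
    (hV : Ψ.IsExtension (ext v) p V) :
    D.γ (Ψ.ψ p) (D.connection V (Ψ.ψ p) (Ψ.dψ p u)) (Ψ.dψ p w)
      = Ψ.h p (Ψ.leviCivita (ext v) p u) w
        + D.U (Ψ.ψ p) (Ψ.dψ p u) (Ψ.dψ p v) * D.ell (Ψ.ψ p) (Ψ.dψ p w) := by
  obtain ⟨U, hU⟩ := Ψ.exists_extension (smoothFieldNear_ext u)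
  obtain ⟨W, hW⟩ := Ψ.exists_extension (smoothFieldNear_ext w)
  -- compare the derivatives of `γ` and of `h` along tangent fields
  have hm : ∀ {a b c : TangentSpace 𝓘(ℝ, E') p} {A B C : VField E M},
      Ψ.IsExtension (ext a) p A → Ψ.IsExtension (ext b) p B → Ψ.IsExtension (ext c) p C →
      D.γ (Ψ.ψ p) (D.connection B (Ψ.ψ p) (Ψ.dψ p a)) (Ψ.dψ p c)
        + D.γ (Ψ.ψ p) (Ψ.dψ p b) (D.connection C (Ψ.ψ p) (Ψ.dψ p a))
        - D.U (Ψ.ψ p) (Ψ.dψ p a) (Ψ.dψ p b) * D.ell (Ψ.ψ p) (Ψ.dψ p c)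
        - D.U (Ψ.ψ p) (Ψ.dψ p a) (Ψ.dψ p c) * D.ell (Ψ.ψ p) (Ψ.dψ p b)
        = Ψ.h p (Ψ.leviCivita (ext b) p a) c + Ψ.h p b (Ψ.leviCivita (ext c) p a) := by
    intro a b c A B C hA hB hC
    have e1 := dir_γ (D := D.toMetricHypersurfaceData) (Ψ.dψ p a) hB.smooth'.mdiff hC.smooth'.mdiff
    have e2 := Ψ.isLeviCivita.covDer_h p a b c
    have e3 : dir (fun q => Ψ.h q (ext b q) (ext c q)) p a
        = dir (fun q => D.γ q (B q) (C q)) (Ψ.ψ p) (Ψ.dψ p a) := by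
      rw [← Ψ.dir_comp_ψ (D.smoothTensor_γ.mdiff hB.smooth'.mdiff hC.smooth'.mdiff)]
      refine dir_congr ?_ _
      filter_upwards [hB.related, hC.related] with q h1 h2
      rw [h1, h2, h_apply]
    have hB' := hB.apply
    have hC' := hC.apply
    rw [ext_self] at hB' hC'
    rw [hB', hC'] at e1
    simp only [covDer2] at e2
    linarith
  have ht : ∀ {a b : TangentSpace 𝓘(ℝ, E') p} {A B : VField E M},
      Ψ.IsExtension (ext a) p A → Ψ.IsExtension (ext b) p B →
      D.connection B (Ψ.ψ p) (Ψ.dψ p a) - D.connection A (Ψ.ψ p) (Ψ.dψ p b)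
        = Ψ.dψ p (Ψ.leviCivita (ext b) p a - Ψ.leviCivita (ext a) p b) := by
    intro a b A B hA hB
    have e1 := connection_sub (D := D.toMetricHypersurfaceData) hA.smooth'.mdiff hB.smooth'.mdiff
    have e2 := Ψ.leviCivita_sub (mdiff_ext a) (mdiff_ext b)
    have hA' := hA.apply
    have hB' := hB.apply
    rw [ext_self] at hA' hB' e2
    rw [ext_self] at e2
    rw [e2, ← hA.lieBr_apply hB, ← e1, hA', hB']
  -- the permutation of arguments that yields the Koszul formula
  have m1 := hm hU hV hW
  have m2 := hm hV hU hW
  have m3 := hm hW hU hV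
  have t1 := congrArg (fun z => D.γ (Ψ.ψ p) z (Ψ.dψ p w)) (ht hU hV)
  have t2 := congrArg (fun z => D.γ (Ψ.ψ p) z (Ψ.dψ p v)) (ht hU hW)
  have t3 := congrArg (fun z => D.γ (Ψ.ψ p) z (Ψ.dψ p u)) (ht hV hW)
  simp only [map_sub, ContinuousLinearMap.sub_apply] at t1 t2 t3
  simp only [h_apply] at m1 m2 m3 ⊢
  rw [D.γ_symm _ (Ψ.dψ p v), D.γ_symm _ (Ψ.dψ p v)] at m1
  rw [D.γ_symm _ (Ψ.dψ p u), D.γ_symm _ (Ψ.dψ p u), D.U_symm _ (Ψ.dψ p v) (Ψ.dψ p u)] at m2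
  rw [D.γ_symm _ (Ψ.dψ p u), D.γ_symm _ (Ψ.dψ p u), D.U_symm _ (Ψ.dψ p w) (Ψ.dψ p u),
    D.U_symm _ (Ψ.dψ p w) (Ψ.dψ p v)] at m3
  linear_combination (1 / 2) * (m1 + m2 - m3 + t1 - t2 - t3)

/-- The Gauss formula: the metric hypersurface connection induces on the submanifold, modulo `n`,
the Levi-Civita connection of `h` plus `U ⊗ ℓ^♯`. -/
theorem exists_connection_eq (u v : TangentSpace 𝓘(ℝ, E') p) {V : VField E M}
    (hV : Ψ.IsExtension (ext v) p V) :
    ∃ c : ℝ, D.connection V (Ψ.ψ p) (Ψ.dψ p u)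
      = Ψ.dψ p (Ψ.leviCivita (ext v) p u + D.U (Ψ.ψ p) (Ψ.dψ p u) (Ψ.dψ p v) • Ψ.ellSharp p)
        + c • D.n (Ψ.ψ p) := by
  obtain ⟨y, c, hy⟩ := Ψ.exists_decomp p (D.connection V (Ψ.ψ p) (Ψ.dψ p u))
  refine ⟨c, ?_⟩
  rw [hy]
  congr 2
  rw [← sub_eq_zero]
  refine Ψ.h_nondegenerate p _ fun w => ?_
  have h1 := Ψ.γ_connection_sub u v w hV
  rw [hy] at h1
  simp only [map_add, map_smul, ContinuousLinearMap.add_apply, ContinuousLinearMap.smul_apply,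
    γ_n D.null, smul_zero, add_zero] at h1
  simp only [map_sub, map_add, map_smul, ContinuousLinearMap.sub_apply,
    ContinuousLinearMap.add_apply, ContinuousLinearMap.smul_apply]
  have h2 : Ψ.h p (Ψ.ellSharp p) w = D.ell (Ψ.ψ p) (Ψ.dψ p w) := Ψ.γ_dψ_ellSharp p w
  rw [h2, h_apply, h1, smul_eq_mul]
  ring

/-- The covariant derivative of `s` along the submanifold, by the Gauss formula and `s(n) = 0`. -/
theorem covDer1_pull1 (v w : TangentSpace 𝓘(ℝ, E') p) :
    covDer1 D.connection D.s (Ψ.ψ p) (Ψ.dψ p v) (Ψ.dψ p w)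
      = covDer1 Ψ.leviCivita (Ψ.pull1 D.s) p v w
        - D.U (Ψ.ψ p) (Ψ.dψ p v) (Ψ.dψ p w) * Ψ.pull1 D.s p (Ψ.ellSharp p) := by
  have hs := smoothTensor_s D.null
  obtain ⟨W, hW⟩ := Ψ.exists_extension (smoothFieldNear_ext w)
  have h1 := covDer1_apply (D := D.connection) hs (Ψ.dψ p v) hW.smooth'.mdiff
  have hW' := hW.apply
  rw [ext_self] at hW'
  obtain ⟨c, hc⟩ := Ψ.exists_connection_eq v w hW
  have hl := hs.linear (Ψ.ψ p)
  have h2 : dir (fun q => Ψ.pull1 D.s q (ext w q)) p v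
      = dir (fun q => D.s q (W q)) (Ψ.ψ p) (Ψ.dψ p v) := by
    rw [← Ψ.dir_comp_ψ (hs.mdiff hW.smooth'.mdiff)]
    refine dir_congr ?_ _
    filter_upwards [hW.related] with q h1
    rw [h1, pull1]
  rw [hW', hc, map_add, map_smul, hl.map_add, hl.map_add, hl.map_smul, hl.map_smul,
    s_n D.null] at h1
  rw [h1, covDer1, h2, pull1, pull1]
  simp only [smul_eq_mul]
  ring

/-- The covariant derivative of `U` along the submanifold, by the Gauss formula and
`U(n, ·) = 0`. -/
theorem covDer2_pull2 (u v w : TangentSpace 𝓘(ℝ, E') p) :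
    covDer2 D.connection D.U (Ψ.ψ p) (Ψ.dψ p u) (Ψ.dψ p v) (Ψ.dψ p w)
      = covDer2 Ψ.leviCivita (Ψ.pull2 D.U) p u v w
        - Ψ.pull2 D.U p u v * Ψ.pull2 D.U p (Ψ.ellSharp p) w
        - Ψ.pull2 D.U p u w * Ψ.pull2 D.U p v (Ψ.ellSharp p) := by
  have hU := smoothTensor_U D.null
  obtain ⟨V, hV⟩ := Ψ.exists_extension (smoothFieldNear_ext v)
  obtain ⟨W, hW⟩ := Ψ.exists_extension (smoothFieldNear_ext w)
  have h1 := covDer2_apply (D := D.connection) hU (Ψ.dψ p u) hV.smooth'.mdiff hW.smooth'.mdiff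
  have hV' := hV.apply
  have hW' := hW.apply
  rw [ext_self] at hV' hW'
  obtain ⟨c, hc⟩ := Ψ.exists_connection_eq u v hV
  obtain ⟨d, hd⟩ := Ψ.exists_connection_eq u w hW
  have hl := hU.linear_left (Ψ.ψ p)
  have hr := hU.linear_right (Ψ.ψ p)
  have h2 : dir (fun q => Ψ.pull2 D.U q (ext v q) (ext w q)) p u
      = dir (fun q => D.U q (V q) (W q)) (Ψ.ψ p) (Ψ.dψ p u) := by
    rw [← Ψ.dir_comp_ψ (hU.mdiff hV.smooth'.mdiff hW.smooth'.mdiff)]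
    refine dir_congr ?_ _
    filter_upwards [hV.related, hW.related] with q h1 h2
    rw [h1, h2, pull2]
  rw [hV', hW', hc, hd, map_add, map_add, map_smul, map_smul, (hl _).map_add, (hl _).map_add,
    (hl _).map_smul, (hl _).map_smul, (hr _).map_add, (hr _).map_add,
    (hr _).map_smul, (hr _).map_smul, U_n D.null, D.U_symm _ _ (D.n _), U_n D.null] at h1
  rw [h1, covDer2, h2]
  simp only [smul_eq_mul, pull2]
  ring

/-! ### The normal component of `Σ` -/

theorem normal_dψ (p : S) (v : TangentSpace 𝓘(ℝ, E') p) : Ψ.normal p (Ψ.dψ p v) = 0 :=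
  (Ψ.exists_normal p).choose_spec.1 v

theorem normal_n (p : S) : Ψ.normal p (D.n (Ψ.ψ p)) = 1 :=
  (Ψ.exists_normal p).choose_spec.2

/-- The normal covector is `ℓ - γ(ℓ^♯_∥, ·)`. -/
theorem normal_apply (p : S) (z : TangentSpace 𝓘(ℝ, E) (Ψ.ψ p)) :
    Ψ.normal p z = D.ell (Ψ.ψ p) z - D.γ (Ψ.ψ p) z (Ψ.dψ p (Ψ.ellSharp p)) := by
  obtain ⟨w, c, rfl⟩ := Ψ.exists_decomp p z
  simp only [map_add, map_smul, ContinuousLinearMap.add_apply, ContinuousLinearMap.smul_apply,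
    Ψ.normal_dψ, Ψ.normal_n, ell_n D.null, γ_n D.null, D.γ_symm _ (Ψ.dψ p w), Ψ.γ_dψ_ellSharp]
  simp

theorem normalSigma_eq (p : S) (v w : TangentSpace 𝓘(ℝ, E') p) :
    Ψ.normalSigma p v w
      = - Ψ.pull2 (lieDer D.n (fun q x y => D.Y q x y)) p v w
        + (covDer1 Ψ.leviCivita (Ψ.pull1 D.s) p v w + covDer1 Ψ.leviCivita (Ψ.pull1 D.s) p w v)
        + (D.ell2 (Ψ.ψ p) - Ψ.ell2Par p) * Ψ.pull2 (lieDer D.n D.U) p v w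
        + 2 * ((1 / 2) * dir D.ell2 (Ψ.ψ p) (D.n (Ψ.ψ p))
          + Ψ.pull2 D.U p (Ψ.ellSharp p) (Ψ.ellSharp p)
          - 2 * Ψ.pull1 D.s p (Ψ.ellSharp p)) * Ψ.pull2 D.U p v w
        - (- covDer2 Ψ.leviCivita (Ψ.pull2 D.U) p (Ψ.ellSharp p) v w
          + covDer2 Ψ.leviCivita (Ψ.pull2 D.U) p v w (Ψ.ellSharp p)
          + covDer2 Ψ.leviCivita (Ψ.pull2 D.U) p w v (Ψ.ellSharp p)) := by
  have h2 : Ψ.ell2Par p = D.ell (Ψ.ψ p) (Ψ.dψ p (Ψ.ellSharp p)) := rfl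
  rw [normalSigma, map_sub, map_smul, Ψ.normal_n, Ψ.normal_apply,
    γ_Sigma D.null, ell_Sigma D.null, Ψ.covDer1_pull1, Ψ.covDer1_pull1, Ψ.covDer2_pull2,
    Ψ.covDer2_pull2, Ψ.covDer2_pull2, h2]
  simp only [pull2, pull1, smul_eq_mul]
  rw [D.U_symm _ (Ψ.dψ p w) (Ψ.dψ p v), D.U_symm _ (Ψ.dψ p (Ψ.ellSharp p)) (Ψ.dψ p v),
    D.U_symm _ (Ψ.dψ p (Ψ.ellSharp p)) (Ψ.dψ p w)]
  ring

end TransverseSubmanifold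
end NullHyp

theorem mainTheorem11
    {E : Type*} [NormedAddCommGroup E] [NormedSpace ℝ E] [FiniteDimensional ℝ E]
    {N : Type*} [TopologicalSpace N] [ChartedSpace E N] [IsManifold 𝓘(ℝ, E) ∞ N]
    {E' : Type*} [NormedAddCommGroup E'] [NormedSpace ℝ E'] [FiniteDimensional ℝ E']
    {S : Type*} [TopologicalSpace S] [ChartedSpace E' S] [IsManifold 𝓘(ℝ, E') ∞ S]
    (D : NullHyp.NullHypersurfaceData E N) (Ψ : NullHyp.TransverseSubmanifold E' S D) :
    (∀ (p : S) (v w : TangentSpace 𝓘(ℝ, E') p),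
      Ψ.frakS p v w =
        - Ψ.normalSigma p v w
        + (1 / 2) * (D.ell2 (Ψ.ψ p) - Ψ.ell2Par p) * Ψ.pull2 (NullHyp.lieDer D.n D.U) p v w
        + ((1 / 2) * NullHyp.dir D.ell2 (Ψ.ψ p) (D.n (Ψ.ψ p))
            + Ψ.pull2 D.U p (Ψ.ellSharp p) (Ψ.ellSharp p)
            - 2 * Ψ.pull1 D.s p (Ψ.ellSharp p)) * Ψ.pull2 D.U p v w) ∧
    ((∀ (q : N) (x y : TangentSpace 𝓘(ℝ, E) q), D.U q x y = 0) →
      ∀ (p : S) (v w : TangentSpace 𝓘(ℝ, E') p),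
        Ψ.frakS p v w = - Ψ.normalSigma p v w) := by
  have main : ∀ (p : S) (v w : TangentSpace 𝓘(ℝ, E') p),
      Ψ.frakS p v w =
        - Ψ.normalSigma p v w
        + (1 / 2) * (D.ell2 (Ψ.ψ p) - Ψ.ell2Par p) * Ψ.pull2 (NullHyp.lieDer D.n D.U) p v w
        + ((1 / 2) * NullHyp.dir D.ell2 (Ψ.ψ p) (D.n (Ψ.ψ p))
            + Ψ.pull2 D.U p (Ψ.ellSharp p) (Ψ.ellSharp p)
            - 2 * Ψ.pull1 D.s p (Ψ.ellSharp p)) * Ψ.pull2 D.U p v w := by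
    intro p v w
    rw [Ψ.normalSigma_eq, NullHyp.TransverseSubmanifold.frakS]
    ring
  refine ⟨main, fun hU p v w => ?_⟩
  have hL : Ψ.pull2 (NullHyp.lieDer D.n D.U) p v w = 0 := by
    simp [NullHyp.TransverseSubmanifold.pull2, NullHyp.lieDer, hU, NullHyp.dir_const]
  have hUp : Ψ.pull2 D.U p v w = 0 := hU _ _ _
  rw [main, hL, hUp]
  ring
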